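/- Let $k$ be a field of characteristic different from $2$ and let $q\in k$, $q\neq 0$. Write $\Delta,\epsilon,S$ for the coproduct, counit and antipode of a Hopf algebra, $\Delta a=\sum a_{(1)}\otimes a_{(2)}$, and $\mathrm{Ad}_R(a)=\sum a_{(2)}\otimes S(a_{(1)})a_{(3)}$. **The data.** $SU_q(2)$ is the Hopf algebra over $k$ generated by $\alpha,\beta,\gamma,\delta$ with relations $$\alpha\beta=q\beta\alpha,\quad \alpha\gamma=q\gamma\alpha,\quad \alpha\delta=\delta\alpha+(q-q^{-1})\beta\gamma,\quad \beta\gamma=\gamma\beta,\quad \beta\delta=q\delta\beta,\quad \gamma\delta=q\delta\gamma,\quad \alpha\delta-q\beta\gamma=1,$$ with the matrix coproduct $\Delta\alpha=\alpha\otimes\alpha+\beta\otimes\gamma$, etc., $\epsilon(\alpha)=\epsilon(\delta)=1$, $\epsilon(\beta)=\epsilon(\gamma)=0$, and $S\alpha=\delta$, $S\delta=\alpha$, $S\beta=-q^{-1}\beta$, $S\gamma=-q\gamma$. Let $P=SO_q(3)\subset SU_q(2)$ be the Hopf subalgebra generated by all products of two generators, and let $A=k[Z,Z^{-1}]$ with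 $\Delta Z=Z\otimes Z$. Let $\pi:P\to A$ be the restriction of the map $\alpha\mapsto Z^{1/2}$, $\delta\mapsto Z^{-1/2}$, $\beta,\gamma\mapsto 0$, and let $\Delta_R=(\mathrm{id}\otimes\pi)\Delta:P\to P\otimes A$. Let $S_q^2\subset P$ be the subalgebra generated by $\alpha\beta$, $\gamma\delta$, $\alpha\delta$. Let $M\subset SU_q(2)$ be the right ideal of the 3D calculus, generated by $$\delta+q^2\alpha-(1+q^2),\quad \gamma^2,\quad \beta\gamma,\quad \beta^2,\quad (\alpha-1)\gamma,\quad (\alpha-1)\beta,$$ and put $M_P=M\cap P$, $M_A=\pi(M_P)$. **Definition.** For an algebra $P$ let $P^2=\ker(P\otimes P\to P)$ be the kernel of the product. Given a Hopf algebra $A$, an algebra $P$ with a linear map $\Delta_R:P\to P\otimes A$, $\Delta_R u=\sum u^{(\bar 1)}\otimes u^{(\bar 2)}$, a subalgebra $B\subset P$, a sub-bimodule $N_P\subset P^2$ and a right ideal $M_A\subset\ker\epsilon\subset A$ with $\mathrm{Ad}_R(M_A)\subset M_A\otimes A$, let $\widetilde{\ }:P\otimes P\to P\otimes A$ be the map $u\otimes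 v\mapsto\sum uv^{(\bar 1)}\otimes v^{(\bar 2)}$. Then $P(B,A,N_P,M_A)$ is a *quantum principal bundle* over $B$ if: $(P,\Delta_R)$ is a right $A$-comodule algebra; $B=\{u\in P:\Delta_R u=u\otimes 1\}$; $\widetilde{\ }:P\otimes P\to P\otimes A$ is surjective; $\Delta_R(N_P)\subset N_P\otimes A$ for the tensor product coaction $u\otimes v\mapsto\sum u^{(\bar 1)}\otimes v^{(\bar 1)}\otimes u^{(\bar 2)}v^{(\bar 2)}$; $\widetilde{\ }(N_P)\subset P\otimes M_A$; and the kernel of the induced map $P^2/N_P\to P\otimes(\ker\epsilon/M_A)$ is $\Gamma_{hor}$, the image of $P\,B^2\,P$ in $P^2/N_P$. When $P$ is a Hopf algebra, $\pi:P\to A$ a Hopf algebra map and $M_P$ a right ideal of $P$ in $\ker\epsilon$, one writes $P(B,A,\pi,M_P,M_A)$ for the case $\Delta_R=(\mathrm{id}\otimes\pi)\Delta$ and $N_P=\kappa(P\otimes M_P)$, where $\kappa(a\otimes a')=\sum aS(a'_{(1)})\otimes a'_{(2)}$. **Proposition.** 1. The map $\pi$ is a surjective Hopf algebra map and is exact,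 i.e. $\ker\pi\subset(\ker\pi|_B)\cdot P$ where $B=\{u\in P:\Delta_R u=u\otimes1\}$; $M_P$ is a right ideal of $P$ contained in $\ker\epsilon$; $M_A$ is an ideal of $A$ contained in $\ker\epsilon$ with $\mathrm{Ad}_R(M_A)\subset M_A\otimes A$; $(\mathrm{id}\otimes\pi)\mathrm{Ad}_R(M_P)\subset M_P\otimes A$; and $M_A=\pi(M_P)$. 2. If $q^2\neq-1$, then $M_A$ is the ideal of $k[Z,Z^{-1}]$ generated by $Z^{-1}+q^4Z-(1+q^4)$. 3. $P(B,A,\pi,M_P,M_A)$ is a quantum principal bundle with base $B=S_q^2$. -/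

import Mathlib

open scoped TensorProduct

namespace QuantumBundle

noncomputable section

universe u

section Bundles

variable {k : Type*} [Field k] {P : Type*} {A : Type*}

/-- `N ⊗ W` as a subspace of `V ⊗ W`. -/
def tensorRight {V : Type*} [AddCommGroup V] [Module k V] (N : Submodule k V)
    (W : Type*) [AddCommGroup W] [Module k W] : Submodule k (V ⊗[k] W) :=
  LinearMap.range (N.subtype.rTensor W)

/-- `V ⊗ N` as a subspace of `V ⊗ W`. -/
def tensorLeft (V : Type*) [AddCommGroup V] [Module k V] {W : Type*} [AddCommGroup W]
    [Module k W] (N : Submodule k W) : Submodule k (V ⊗[k] W) :=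
  LinearMap.range (N.subtype.lTensor V)

/-- `M` is a right ideal. -/
def IsRightIdeal [Ring A] [Algebra k A] (M : Submodule k A) : Prop :=
  ∀ m ∈ M, ∀ a : A, m * a ∈ M

/-- The right ideal generated by a set. -/
def rightIdealSpan (k : Type*) [Field k] [Ring A] [Algebra k A] (s : Set A) : Submodule k A :=
  (Submodule.span (MulOpposite A) s).restrictScalars k

/-- The bimodule `P²` of universal one-forms, the kernel of the product `P ⊗ P → P`. -/
def universalForms (k P : Type*) [Field k] [Ring P] [Algebra k P] : Submodule k (P ⊗[k] P) :=
  LinearMap.ker (LinearMap.mul' k P)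

section Comodule

variable [Ring P] [Algebra k P] [Ring A] [HopfAlgebra k A]

/-- `ρ` makes `P` a right `A`-comodule algebra. -/
structure IsRightComoduleAlgebra (ρ : P →ₐ[k] P ⊗[k] A) : Prop where
  coassoc : ∀ u, TensorProduct.assoc k P A A (ρ.toLinearMap.rTensor A (ρ u)) =
    (Coalgebra.comul (R := k) (A := A)).lTensor P (ρ u)
  counit : ∀ u, (Coalgebra.counit (R := k) (A := A)).lTensor P (ρ u) = u ⊗ₜ[k] 1

/-- The fixed point subalgebra `P^A = {u | ρ u = u ⊗ 1}`. -/
def coinvariants (ρ : P →ₐ[k] P ⊗[k] A) : Subalgebra k P :=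
  AlgHom.equalizer ρ Algebra.TensorProduct.includeLeft

/-- The map `(· ⊗ id)(id ⊗ ρ) : P ⊗ P → P ⊗ A`, `u ⊗ v ↦ u v⁽¹⁾ ⊗ v⁽²⁾`. On one-forms it is the
map generating the fundamental vector fields. -/
def tildeMap (ρ : P →ₐ[k] P ⊗[k] A) : P ⊗[k] P →ₗ[k] P ⊗[k] A :=
  (LinearMap.mul' k P).rTensor A ∘ₗ (TensorProduct.assoc k P P A).symm.toLinearMap ∘ₗ
    ρ.toLinearMap.lTensor P

/-- The coaction on `P ⊗ P ⊇ P²`: `u ⊗ v ↦ u⁽¹⁾ ⊗ v⁽¹⁾ ⊗ u⁽²⁾ v⁽²⁾`. -/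
def coactionForms (ρ : P →ₐ[k] P ⊗[k] A) : P ⊗[k] P →ₗ[k] (P ⊗[k] P) ⊗[k] A :=
  (LinearMap.mul' k A).lTensor (P ⊗[k] P) ∘ₗ
    (TensorProduct.tensorTensorTensorComm k P A P A).toLinearMap ∘ₗ
      TensorProduct.map ρ.toLinearMap ρ.toLinearMap

/-- The bimodule actions on `P ⊗ P`: `x ↦ u · x · v`. -/
def bimulForms (u v : P) : P ⊗[k] P →ₗ[k] P ⊗[k] P :=
  TensorProduct.map (LinearMap.mulLeft k u) (LinearMap.mulRight k v)

/-- `N` is a sub-bimodule of `P²`. -/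
structure IsSubbimoduleOfForms (N : Submodule k (P ⊗[k] P)) : Prop where
  le : N ≤ universalForms k P
  bimul_mem : ∀ u v : P, ∀ x ∈ N, bimulForms u v x ∈ N

/-- The one-forms `Γ_P = P² / N` of the calculus defined by `N`. -/
abbrev Forms (N : Submodule k (P ⊗[k] P)) : Type _ :=
  universalForms k P ⧸ N.submoduleOf (universalForms k P)

/-- The horizontal forms `P j(B²) P` in `P²`, where `j : B → P` is the inclusion. -/
def universalHorizontal (B : Subalgebra k P) : Submodule k (P ⊗[k] P) :=
  Submodule.span k {x | ∃ u v : P, ∃ w ∈ universalForms k B,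
    x = bimulForms u v (TensorProduct.map B.val.toLinearMap B.val.toLinearMap w)}

/-- The horizontal forms `Γ_hor` in `Γ_P`: the image of `P j(B²) P`. -/
def horizontalForms (B : Subalgebra k P) (N : Submodule k (P ⊗[k] P)) :
    Submodule k (Forms N) :=
  ((universalHorizontal B).submoduleOf (universalForms k P)).map
    (N.submoduleOf (universalForms k P)).mkQ

/-- The map on `Γ_P = P² / N` induced by `tildeMap ρ`. On `P²` the latter has values in
`P ⊗ ker ε`, and we regard `P ⊗ (ker ε / M)` as a subspace of `P ⊗ (A / M)`. -/
def tildeForms (ρ : P →ₐ[k] P ⊗[k] A) (N : Submodule k (P ⊗[k] P)) (M : Submodule k A)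
    (h : N.map (tildeMap ρ) ≤ tensorLeft P M) : Forms N →ₗ[k] P ⊗[k] (A ⧸ M) :=
  (N.submoduleOf (universalForms k P)).liftQ
    (M.mkQ.lTensor P ∘ₗ tildeMap ρ ∘ₗ (universalForms k P).subtype) (by
      intro x hx
      obtain ⟨y, hy⟩ := h (Submodule.mem_map_of_mem hx)
      change M.mkQ.lTensor P (tildeMap ρ x) = 0
      have hy' : (M.subtype.lTensor P) y = tildeMap ρ x := hy
      rw [← hy', ← LinearMap.comp_apply, ← LinearMap.lTensor_comp]
      have h0 : M.mkQ ∘ₗ M.subtype = 0 := by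
        ext m
        simp
      rw [h0, LinearMap.lTensor_zero, LinearMap.zero_apply])

end Comodule

section Hopf

variable [Ring A] [HopfAlgebra k A]

/-- The right adjoint coaction `a ↦ a₍₂₎ ⊗ S(a₍₁₎) a₍₃₎`. -/
def Ad (k A : Type*) [Field k] [Ring A] [HopfAlgebra k A] : A →ₗ[k] A ⊗[k] A :=
  (LinearMap.mul' k A ∘ₗ (HopfAlgebra.antipode k (A := A)).rTensor A).lTensor A ∘ₗ
    (TensorProduct.leftComm k A A A).toLinearMap ∘ₗ
      (Coalgebra.comul (R := k) (A := A)).lTensor A ∘ₗ Coalgebra.comul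

/-- The map `κ : a ⊗ a' ↦ a S(a'₍₁₎) ⊗ a'₍₂₎`. -/
def kappa (k A : Type*) [Field k] [Ring A] [HopfAlgebra k A] : A ⊗[k] A →ₗ[k] A ⊗[k] A :=
  (LinearMap.mul' k A).rTensor A ∘ₗ (TensorProduct.assoc k A A A).symm.toLinearMap ∘ₗ
    ((HopfAlgebra.antipode k (A := A)).rTensor A ∘ₗ Coalgebra.comul).lTensor A

/-- `M` is a right ideal in `ker ε`; such `M` define the left-covariant calculi on `A`. -/
structure IsLeftCovariantIdeal (M : Submodule k A) : Prop where
  rightIdeal : IsRightIdeal M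
  le_ker : M ≤ LinearMap.ker (Coalgebra.counit (R := k) (A := A))

/-- `M` is an `Ad`-invariant right ideal in `ker ε`; such `M` define the bicovariant calculi. -/
structure IsBicovariantIdeal (M : Submodule k A) : Prop extends IsLeftCovariantIdeal M where
  map_Ad_le : M.map (Ad k A) ≤ tensorRight M A

/-- The sub-bimodule `κ(A ⊗ M)` of `A²` defining the calculus with right ideal `M`. -/
def formsOfIdeal (M : Submodule k A) : Submodule k (A ⊗[k] A) :=
  (tensorLeft A M).map (kappa k A)

/-- `P(B, A, N, M)` is a quantum principal bundle with coaction `ρ`, base `B` and quantum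
differential calculi defined by the sub-bimodule `N` of `P²` and the right ideal `M` of `A`. -/
structure IsQuantumPrincipalBundle [Ring P] [Algebra k P] (ρ : P →ₐ[k] P ⊗[k] A)
    (B : Subalgebra k P) (N : Submodule k (P ⊗[k] P)) (M : Submodule k A) : Prop where
  calculus_total : IsSubbimoduleOfForms N
  calculus_fiber : IsBicovariantIdeal M
  comodule : IsRightComoduleAlgebra ρ
  base : B = coinvariants ρ
  free : Function.Surjective (tildeMap ρ)
  covariant : N.map (coactionForms ρ) ≤ tensorRight N A
  compatible : N.map (tildeMap ρ) ≤ tensorLeft P M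
  exact : LinearMap.ker (tildeForms ρ N M compatible) = horizontalForms B N

variable [Ring P] [HopfAlgebra k P]

/-- The coaction `(id ⊗ π) Δ` of `A` on `P` induced by a Hopf algebra map `π : P → A`. -/
def pushCoaction (π : P →ₐc[k] A) : P →ₐ[k] P ⊗[k] A :=
  (Algebra.TensorProduct.map (AlgHom.id k P) (π : P →ₐ[k] A)).comp (Bialgebra.comulAlgHom k P)

/-- `π` is exact: `ker π ⊆ (ker π|_B) · P`, where `B` is the quantum homogeneous space. -/
def IsExactProjection (π : P →ₐc[k] A) : Prop :=
  LinearMap.ker (π : P →ₗ[k] A) ≤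
    (Subalgebra.toSubmodule (coinvariants (pushCoaction π)) ⊓ LinearMap.ker (π : P →ₗ[k] A)) * ⊤

/-- The data `(P, A, π, M_P, M_A)` of a quantum homogeneous bundle with non-universal calculi:
`π` is an exact surjection of Hopf algebras, `M_P` defines a left-covariant calculus on `P`,
`M_A` a bicovariant one on `A`, `(id ⊗ π) Ad (M_P) ⊆ M_P ⊗ A` and `M_A = π(M_P)`. -/
structure IsHomogeneousBundleData (π : P →ₐc[k] A) (MP : Submodule k P) (MA : Submodule k A) :
    Prop where
  surjective : Function.Surjective π
  exact : IsExactProjection π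
  calculus_total : IsLeftCovariantIdeal MP
  calculus_fiber : IsBicovariantIdeal MA
  map_Ad_le : MP.map ((π : P →ₗ[k] A).lTensor P ∘ₗ Ad k P) ≤ tensorRight MP A
  eq_map : MA = MP.map (π : P →ₗ[k] A)

end Hopf
end Bundles

/-- The four generators, the entries of the quantum matrix `(α β ; γ δ)`. -/
inductive Gen : Type
  | α | β | γ | δ

section SUq2

variable {k : Type u} [Field k]

/-- A quadruple `(a, b ; c, d)` in a `k`-algebra that satisfies the defining relations of
`SU_q(2)`. -/
structure IsQuantumMatrix {R : Type*} [Ring R] [Algebra k R] (q : kˣ) (a b c d : R) : Prop where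
  ab : a * b = (q : k) • (b * a)
  ac : a * c = (q : k) • (c * a)
  ad : a * d = d * a + ((q : k) - (q : k)⁻¹) • (b * c)
  bc : b * c = c * b
  bd : b * d = (q : k) • (d * b)
  cd : c * d = (q : k) • (d * c)
  det : a * d - (q : k) • (b * c) = 1

/-- The relations of `SU_q(2)` on the free algebra on `α, β, γ, δ`. -/
inductive SUq2Rel (q : kˣ) : FreeAlgebra k Gen → FreeAlgebra k Gen → Prop
  | ab : SUq2Rel q (.ι k .α * .ι k .β) ((q : k) • (.ι k .β * .ι k .α))
  | ac : SUq2Rel q (.ι k .α * .ι k .γ) ((q : k) • (.ι k .γ * .ι k .α))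
  | ad : SUq2Rel q (.ι k .α * .ι k .δ)
      (.ι k .δ * .ι k .α + ((q : k) - (q : k)⁻¹) • (.ι k .β * .ι k .γ))
  | bc : SUq2Rel q (.ι k .β * .ι k .γ) (.ι k .γ * .ι k .β)
  | bd : SUq2Rel q (.ι k .β * .ι k .δ) ((q : k) • (.ι k .δ * .ι k .β))
  | cd : SUq2Rel q (.ι k .γ * .ι k .δ) ((q : k) • (.ι k .δ * .ι k .γ))
  | det : SUq2Rel q (.ι k .α * .ι k .δ - (q : k) • (.ι k .β * .ι k .γ)) 1

/-- The (coordinate algebra of the) quantum group `SU_q(2)`. -/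
def SUq2 (q : kˣ) : Type u := RingQuot (SUq2Rel q)

instance (q : kˣ) : Ring (SUq2 q) := inferInstanceAs (Ring (RingQuot (SUq2Rel q)))
instance (q : kˣ) : Algebra k (SUq2 q) := inferInstanceAs (Algebra k (RingQuot (SUq2Rel q)))

namespace SUq2

/-- The generators of `SU_q(2)`. -/
def gen (q : kˣ) (g : Gen) : SUq2 q := RingQuot.mkAlgHom k (SUq2Rel q) (FreeAlgebra.ι k g)

/-- The generator `α`. -/
def α (q : kˣ) : SUq2 q := gen q .α
/-- The generator `β`. -/
def β (q : kˣ) : SUq2 q := gen q .β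
/-- The generator `γ`. -/
def γ (q : kˣ) : SUq2 q := gen q .γ
/-- The generator `δ`. -/
def δ (q : kˣ) : SUq2 q := gen q .δ

theorem isQuantumMatrix (q : kˣ) : IsQuantumMatrix q (α q) (β q) (γ q) (δ q) where
  ab := by simpa [α, β, gen] using! RingQuot.mkAlgHom_rel k (SUq2Rel.ab (q := q))
  ac := by simpa using! RingQuot.mkAlgHom_rel k (SUq2Rel.ac (q := q))
  ad := by simpa using! RingQuot.mkAlgHom_rel k (SUq2Rel.ad (q := q))
  bc := by simpa using! RingQuot.mkAlgHom_rel k (SUq2Rel.bc (q := q))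
  bd := by simpa using! RingQuot.mkAlgHom_rel k (SUq2Rel.bd (q := q))
  cd := by simpa using! RingQuot.mkAlgHom_rel k (SUq2Rel.cd (q := q))
  det := by simpa using! RingQuot.mkAlgHom_rel k (SUq2Rel.det (q := q))

/-- Choice of an entry of a quadruple. -/
def entry {R : Type*} (a b c d : R) : Gen → R
  | .α => a
  | .β => b
  | .γ => c
  | .δ => d

variable {R : Type*} [Ring R] [Algebra k R] {q : kˣ}

/-- The algebra map out of `SU_q(2)` given by the images of the generators. -/
def lift {a b c d : R} (h : IsQuantumMatrix q a b c d) : SUq2 q →ₐ[k] R :=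
  RingQuot.liftAlgHom k ⟨FreeAlgebra.lift k (entry a b c d), by
    intro x y hxy
    cases hxy <;> simp [entry, h.ab, h.ac, h.ad, h.bd, h.cd]
    · simpa using h.bc
    · simpa [sub_eq_iff_eq_add, h.ad] using h.det⟩

section
variable {a b c d : R} (h : IsQuantumMatrix q a b c d)

theorem lift_gen (g : Gen) : lift h (gen q g) = entry a b c d g := by
  unfold lift gen
  erw [RingQuot.liftAlgHom_mkAlgHom_apply]
  simp

@[simp] theorem lift_α : lift h (α q) = a := lift_gen h _
@[simp] theorem lift_β : lift h (β q) = b := lift_gen h _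
@[simp] theorem lift_γ : lift h (γ q) = c := lift_gen h _
@[simp] theorem lift_δ : lift h (δ q) = d := lift_gen h _

end

theorem hom_ext {S : Type*} [Semiring S] [Algebra k S] {f g : SUq2 q →ₐ[k] S}
    (h : ∀ x, f (gen q x) = g (gen q x)) : f = g :=
  RingQuot.ringQuot_ext' k f g (FreeAlgebra.hom_ext (funext h))

theorem hom_ext' {S : Type*} [Semiring S] [Algebra k S] {f g : SUq2 q →ₐ[k] S}
    (ha : f (α q) = g (α q)) (hb : f (β q) = g (β q)) (hc : f (γ q) = g (γ q))
    (hd : f (δ q) = g (δ q)) : f = g :=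
  hom_ext (by rintro (_ | _ | _ | _) <;> assumption)

theorem adjoin_gen (q : kˣ) : Algebra.adjoin k (Set.range (gen q)) = ⊤ := by
  rw [eq_top_iff]
  rintro x -
  obtain ⟨y, rfl⟩ := RingQuot.mkAlgHom_surjective k (SUq2Rel q) x
  induction y using FreeAlgebra.induction with
  | grade0 r =>
    rw [AlgHom.commutes]
    exact Subalgebra.algebraMap_mem _ r
  | grade1 g => exact Algebra.subset_adjoin ⟨g, rfl⟩
  | mul a b ha hb =>
    rw [map_mul]
    exact mul_mem ha hb
  | add a b ha hb =>
    rw [map_add]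
    exact add_mem ha hb

theorem δ_mul_β (q : kˣ) : δ q * β q = (q : k)⁻¹ • (β q * δ q) := by
  rw [(isQuantumMatrix q).bd, smul_smul]; simp

theorem δ_mul_γ (q : kˣ) : δ q * γ q = (q : k)⁻¹ • (γ q * δ q) := by
  rw [(isQuantumMatrix q).cd, smul_smul]; simp

theorem γ_mul_β (q : kˣ) : γ q * β q = β q * γ q := (isQuantumMatrix q).bc.symm

theorem α_mul_δ (q : kˣ) : α q * δ q = 1 + (q : k) • (β q * γ q) := by
  rw [← (isQuantumMatrix q).det]; abel

theorem δ_mul_α (q : kˣ) : δ q * α q = 1 + (q : k)⁻¹ • (β q * γ q) := by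
  have := (isQuantumMatrix q).ad
  rw [α_mul_δ, ← sub_eq_iff_eq_add] at this
  rw [← this]
  module

theorem comul_rel (q : kˣ) : IsQuantumMatrix q
    (α q ⊗ₜ[k] α q + β q ⊗ₜ[k] γ q) (α q ⊗ₜ[k] β q + β q ⊗ₜ[k] δ q)
    (γ q ⊗ₜ[k] α q + δ q ⊗ₜ[k] γ q) (γ q ⊗ₜ[k] β q + δ q ⊗ₜ[k] δ q) := by
  have h := isQuantumMatrix q
  have hq : (q : k) ≠ 0 := q.ne_zero
  constructor <;>
  · simp only [mul_add, add_mul, Algebra.TensorProduct.tmul_mul_tmul, h.ab, h.ac, γ_mul_β,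
      δ_mul_β, δ_mul_γ, α_mul_δ, δ_mul_α,
      TensorProduct.tmul_smul, ← TensorProduct.smul_tmul', TensorProduct.tmul_add,
      TensorProduct.add_tmul, smul_add, smul_smul, ← Algebra.TensorProduct.one_def]
    match_scalars <;> field_simp <;> ring

theorem counit_rel (q : kˣ) : IsQuantumMatrix q (1 : k) 0 0 1 := by
  constructor <;> simp

theorem antipode_rel (q : kˣ) : IsQuantumMatrix q (MulOpposite.op (δ q))
    (MulOpposite.op (-(q : k)⁻¹ • β q)) (MulOpposite.op (-(q : k) • γ q))
    (MulOpposite.op (α q)) := by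
  have h := isQuantumMatrix q
  have hq : (q : k) ≠ 0 := q.ne_zero
  constructor <;>
  · apply MulOpposite.unop_injective
    simp only [MulOpposite.unop_mul, MulOpposite.unop_op, MulOpposite.unop_smul,
      MulOpposite.unop_add, MulOpposite.unop_sub, MulOpposite.unop_one,
      h.ab, h.ac, γ_mul_β,
      δ_mul_β, δ_mul_γ, α_mul_δ, δ_mul_α, smul_smul, mul_smul_comm, smul_mul_assoc]
    match_scalars <;> field_simp <;> ring

/-- The comultiplication as an algebra map: `Δ α = α ⊗ α + β ⊗ γ` and so on. -/
def comulHom (q : kˣ) : SUq2 q →ₐ[k] SUq2 q ⊗[k] SUq2 q := lift (comul_rel q)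

/-- The counit as an algebra map. -/
def counitHom (q : kˣ) : SUq2 q →ₐ[k] k := lift (counit_rel q)

/-- The antipode as an algebra map into the opposite algebra:
`S α = δ`, `S β = -q⁻¹ β`, `S γ = -q γ`, `S δ = α`. -/
def antipodeHom (q : kˣ) : SUq2 q →ₐ[k] (SUq2 q)ᵐᵒᵖ := lift (antipode_rel q)

instance (q : kˣ) : Bialgebra k (SUq2 q) :=
  Bialgebra.ofAlgHom (comulHom q) (counitHom q)
    (by
      apply hom_ext' <;> simp [comulHom, TensorProduct.tmul_add, TensorProduct.add_tmul] <;> abel)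
    (by apply hom_ext' <;> simp [comulHom, counitHom])
    (by apply hom_ext' <;> simp [comulHom, counitHom])

theorem comul_α (q : kˣ) : Coalgebra.comul (R := k) (α q) =
    α q ⊗ₜ[k] α q + β q ⊗ₜ[k] γ q := lift_α (comul_rel q)
theorem comul_β (q : kˣ) : Coalgebra.comul (R := k) (β q) =
    α q ⊗ₜ[k] β q + β q ⊗ₜ[k] δ q := lift_β (comul_rel q)
theorem comul_γ (q : kˣ) : Coalgebra.comul (R := k) (γ q) =
    γ q ⊗ₜ[k] α q + δ q ⊗ₜ[k] γ q := lift_γ (comul_rel q)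
theorem comul_δ (q : kˣ) : Coalgebra.comul (R := k) (δ q) =
    γ q ⊗ₜ[k] β q + δ q ⊗ₜ[k] δ q := lift_δ (comul_rel q)
theorem counit_α (q : kˣ) : Coalgebra.counit (R := k) (α q) = 1 := lift_α (counit_rel q)
theorem counit_β (q : kˣ) : Coalgebra.counit (R := k) (β q) = 0 := lift_β (counit_rel q)
theorem counit_γ (q : kˣ) : Coalgebra.counit (R := k) (γ q) = 0 := lift_γ (counit_rel q)
theorem counit_δ (q : kˣ) : Coalgebra.counit (R := k) (δ q) = 1 := lift_δ (counit_rel q)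

end SUq2
end SUq2

section Antipode

variable {k : Type*} {H : Type*} [CommRing k] [Ring H] [Bialgebra k H]

/-- The antipode axioms hold on all of `H` once they hold on algebra generators. -/
theorem antipode_left_of_adjoin (S : H →ₐ[k] Hᵐᵒᵖ) (s : Set H) (hs : Algebra.adjoin k s = ⊤)
    (h : ∀ x ∈ s, LinearMap.mul' k H
      (((MulOpposite.opLinearEquiv k).symm.toLinearMap ∘ₗ S.toLinearMap).rTensor H
        (Coalgebra.comul x)) = algebraMap k H (Coalgebra.counit x)) (x : H) :
    LinearMap.mul' k H
      (((MulOpposite.opLinearEquiv k).symm.toLinearMap ∘ₗ S.toLinearMap).rTensor H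
        (Coalgebra.comul x)) = algebraMap k H (Coalgebra.counit x) := by
  have hx : x ∈ Algebra.adjoin k s := hs ▸ Algebra.mem_top
  induction hx using Algebra.adjoin_induction with
  | mem x hx => exact h x hx
  | algebraMap r => simp [Algebra.TensorProduct.algebraMap_apply]
  | add a b _ _ ha hb => simp only [map_add, ha, hb]
  | mul a b _ _ ha hb =>
    rw [Bialgebra.comul_mul, Bialgebra.counit_mul, map_mul (algebraMap k H), ← hb]
    generalize Coalgebra.comul (R := k) b = u
    induction u with
    | zero => simp
    | add u v hu hv => rw [mul_add, map_add, map_add, hu, hv, map_add, map_add, mul_add]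
    | tmul c d =>
      have key : ∀ t : H ⊗[k] H, LinearMap.mul' k H
          (((MulOpposite.opLinearEquiv k).symm.toLinearMap ∘ₗ S.toLinearMap).rTensor H
            (t * c ⊗ₜ d)) = (S c).unop * LinearMap.mul' k H
          (((MulOpposite.opLinearEquiv k).symm.toLinearMap ∘ₗ S.toLinearMap).rTensor H t) * d := by
        intro t
        induction t with
        | zero => simp
        | add u v hu hv => simp only [add_mul, map_add, hu, hv, mul_add]
        | tmul a b => simp [mul_assoc]
      rw [key, ha, ← Algebra.commutes, mul_assoc]
      simp

theorem antipode_right_of_adjoin (S : H →ₐ[k] Hᵐᵒᵖ) (s : Set H) (hs : Algebra.adjoin k s = ⊤)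
    (h : ∀ x ∈ s, LinearMap.mul' k H
      (((MulOpposite.opLinearEquiv k).symm.toLinearMap ∘ₗ S.toLinearMap).lTensor H
        (Coalgebra.comul x)) = algebraMap k H (Coalgebra.counit x)) (x : H) :
    LinearMap.mul' k H
      (((MulOpposite.opLinearEquiv k).symm.toLinearMap ∘ₗ S.toLinearMap).lTensor H
        (Coalgebra.comul x)) = algebraMap k H (Coalgebra.counit x) := by
  have hx : x ∈ Algebra.adjoin k s := hs ▸ Algebra.mem_top
  induction hx using Algebra.adjoin_induction with
  | mem x hx => exact h x hx
  | algebraMap r => simp [Algebra.TensorProduct.algebraMap_apply]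
  | add a b _ _ ha hb => simp only [map_add, ha, hb]
  | mul a b _ _ ha hb =>
    rw [Bialgebra.comul_mul, Bialgebra.counit_mul, map_mul (algebraMap k H), ← ha]
    generalize Coalgebra.comul (R := k) a = u
    induction u with
    | zero => simp
    | add u v hu hv => rw [add_mul, map_add, map_add, hu, hv, map_add, map_add, add_mul]
    | tmul c d =>
      have key : ∀ t : H ⊗[k] H, LinearMap.mul' k H
          (((MulOpposite.opLinearEquiv k).symm.toLinearMap ∘ₗ S.toLinearMap).lTensor H
            (c ⊗ₜ d * t)) = c * LinearMap.mul' k H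
          (((MulOpposite.opLinearEquiv k).symm.toLinearMap ∘ₗ S.toLinearMap).lTensor H t) *
            (S d).unop := by
        intro t
        induction t with
        | zero => simp
        | add u v hu hv => simp only [add_mul, map_add, hu, hv, mul_add]
        | tmul a b => simp [mul_assoc]
      rw [key, hb, mul_assoc, Algebra.commutes, ← mul_assoc]
      simp

end Antipode

section SUq2Hopf

variable {k : Type u} [Field k]

namespace SUq2

theorem antipodeHom_α (q : kˣ) : antipodeHom q (α q) = MulOpposite.op (δ q) :=
  lift_α (antipode_rel q)
theorem antipodeHom_β (q : kˣ) : antipodeHom q (β q) = MulOpposite.op (-(q : k)⁻¹ • β q) :=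
  lift_β (antipode_rel q)
theorem antipodeHom_γ (q : kˣ) : antipodeHom q (γ q) = MulOpposite.op (-(q : k) • γ q) :=
  lift_γ (antipode_rel q)
theorem antipodeHom_δ (q : kˣ) : antipodeHom q (δ q) = MulOpposite.op (α q) :=
  lift_δ (antipode_rel q)

instance (q : kˣ) : HopfAlgebra k (SUq2 q) where
  antipode := (MulOpposite.opLinearEquiv k).symm.toLinearMap ∘ₗ (antipodeHom q).toLinearMap
  mul_antipode_rTensor_comul := by
    ext x
    refine antipode_left_of_adjoin (antipodeHom q) _ (adjoin_gen q) ?_ x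
    have hq : (q : k) ≠ 0 := q.ne_zero
    have h := isQuantumMatrix q
    rintro _ ⟨_ | _ | _ | _, rfl⟩
    · rw [show gen q .α = α q from rfl, comul_α, counit_α]
      simp only [map_add, LinearMap.rTensor_tmul, LinearMap.mul'_apply, LinearMap.comp_apply,
        AlgHom.toLinearMap_apply, LinearEquiv.coe_coe, antipodeHom_α, antipodeHom_β,
        MulOpposite.coe_opLinearEquiv_symm, MulOpposite.unop_op, map_one, δ_mul_α, smul_mul_assoc]
      module
    · rw [show gen q .β = β q from rfl, comul_β, counit_β]
      simp only [map_add, LinearMap.rTensor_tmul, LinearMap.mul'_apply, LinearMap.comp_apply,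
        AlgHom.toLinearMap_apply, LinearEquiv.coe_coe, antipodeHom_α, antipodeHom_β,
        MulOpposite.coe_opLinearEquiv_symm, MulOpposite.unop_op, map_zero, δ_mul_β, smul_mul_assoc]
      module
    · rw [show gen q .γ = γ q from rfl, comul_γ, counit_γ]
      simp only [map_add, LinearMap.rTensor_tmul, LinearMap.mul'_apply, LinearMap.comp_apply,
        AlgHom.toLinearMap_apply, LinearEquiv.coe_coe, antipodeHom_γ, antipodeHom_δ,
        MulOpposite.coe_opLinearEquiv_symm, MulOpposite.unop_op, map_zero, h.ac, smul_mul_assoc]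
      module
    · rw [show gen q .δ = δ q from rfl, comul_δ, counit_δ]
      simp only [map_add, LinearMap.rTensor_tmul, LinearMap.mul'_apply, LinearMap.comp_apply,
        AlgHom.toLinearMap_apply, LinearEquiv.coe_coe, antipodeHom_γ, antipodeHom_δ,
        MulOpposite.coe_opLinearEquiv_symm, MulOpposite.unop_op, map_one, α_mul_δ, γ_mul_β,
        smul_mul_assoc]
      module
  mul_antipode_lTensor_comul := by
    ext x
    refine antipode_right_of_adjoin (antipodeHom q) _ (adjoin_gen q) ?_ x
    have hq : (q : k) ≠ 0 := q.ne_zero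
    have h := isQuantumMatrix q
    rintro _ ⟨_ | _ | _ | _, rfl⟩
    · rw [show gen q .α = α q from rfl, comul_α, counit_α]
      simp only [map_add, LinearMap.lTensor_tmul, LinearMap.mul'_apply, LinearMap.comp_apply,
        AlgHom.toLinearMap_apply, LinearEquiv.coe_coe, antipodeHom_α, antipodeHom_γ,
        MulOpposite.coe_opLinearEquiv_symm, MulOpposite.unop_op, map_one, α_mul_δ, mul_smul_comm]
      module
    · rw [show gen q .β = β q from rfl, comul_β, counit_β]
      simp only [map_add, LinearMap.lTensor_tmul, LinearMap.mul'_apply, LinearMap.comp_apply,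
        AlgHom.toLinearMap_apply, LinearEquiv.coe_coe, antipodeHom_β, antipodeHom_δ,
        MulOpposite.coe_opLinearEquiv_symm, MulOpposite.unop_op, map_zero, h.ab, mul_smul_comm]
      match_scalars; field_simp; ring
    · rw [show gen q .γ = γ q from rfl, comul_γ, counit_γ]
      simp only [map_add, LinearMap.lTensor_tmul, LinearMap.mul'_apply, LinearMap.comp_apply,
        AlgHom.toLinearMap_apply, LinearEquiv.coe_coe, antipodeHom_α, antipodeHom_γ,
        MulOpposite.coe_opLinearEquiv_symm, MulOpposite.unop_op, map_zero, δ_mul_γ, mul_smul_comm]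
      match_scalars; field_simp; ring
    · rw [show gen q .δ = δ q from rfl, comul_δ, counit_δ]
      simp only [map_add, LinearMap.lTensor_tmul, LinearMap.mul'_apply, LinearMap.comp_apply,
        AlgHom.toLinearMap_apply, LinearEquiv.coe_coe, antipodeHom_β, antipodeHom_δ,
        MulOpposite.coe_opLinearEquiv_symm, MulOpposite.unop_op, map_one, δ_mul_α, γ_mul_β,
        mul_smul_comm]
      module

theorem antipode_α (q : kˣ) : HopfAlgebra.antipode k (α q) = δ q :=
  congrArg MulOpposite.unop (antipodeHom_α q)
theorem antipode_β (q : kˣ) : HopfAlgebra.antipode k (β q) = -(q : k)⁻¹ • β q :=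
  congrArg MulOpposite.unop (antipodeHom_β q)
theorem antipode_γ (q : kˣ) : HopfAlgebra.antipode k (γ q) = -(q : k) • γ q :=
  congrArg MulOpposite.unop (antipodeHom_γ q)
theorem antipode_δ (q : kˣ) : HopfAlgebra.antipode k (δ q) = α q :=
  congrArg MulOpposite.unop (antipodeHom_δ q)

end SUq2
end SUq2Hopf

section HopfSubalgebra

variable {k : Type*} {H : Type*} [Field k] [Ring H] [HopfAlgebra k H]

/-- The inclusion `P ⊗ P → H ⊗ H` for a subalgebra `P` of `H`. -/
def tensorVal (P : Subalgebra k H) : P ⊗[k] P →ₐ[k] H ⊗[k] H :=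
  Algebra.TensorProduct.map P.val P.val

theorem tensorVal_injective (P : Subalgebra k H) : Function.Injective (tensorVal P) :=
  TensorProduct.map_injective_of_flat_flat P.val.toLinearMap P.val.toLinearMap
    Subtype.val_injective Subtype.val_injective

/-- A subalgebra `P` of a Hopf algebra with `Δ P ⊆ P ⊗ P` and `S P ⊆ P`. -/
structure IsHopfSubalgebra (P : Subalgebra k H) : Prop where
  comul_mem : ∀ p ∈ P, Coalgebra.comul (R := k) p ∈ (tensorVal P).range
  antipode_mem : ∀ p ∈ P, HopfAlgebra.antipode k p ∈ P

namespace IsHopfSubalgebra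

variable {P : Subalgebra k H} (hP : IsHopfSubalgebra P)

/-- The restricted comultiplication `P → P ⊗ P`. -/
def comulHom : P →ₐ[k] P ⊗[k] P :=
  (AlgEquiv.ofInjective (tensorVal P) (tensorVal_injective P)).symm.toAlgHom.comp
    (((Bialgebra.comulAlgHom k H).comp P.val).codRestrict (tensorVal P).range
      fun p => hP.comul_mem p p.2)

theorem tensorVal_comulHom (p : P) :
    tensorVal P (hP.comulHom p) = Coalgebra.comul (R := k) (p : H) :=
  congrArg Subtype.val ((AlgEquiv.ofInjective (tensorVal P) (tensorVal_injective P)).apply_symm_apply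
    ⟨Coalgebra.comul (R := k) (p : H), hP.comul_mem p p.2⟩)

/-- The restricted antipode `P → P`. -/
def antipodeMap : P →ₗ[k] P :=
  (HopfAlgebra.antipode k (A := H)).restrict (p := Subalgebra.toSubmodule P)
    (q := Subalgebra.toSubmodule P) hP.antipode_mem

theorem coe_antipodeMap (p : P) : (hP.antipodeMap p : H) = HopfAlgebra.antipode k (p : H) := rfl

theorem coassoc : (Algebra.TensorProduct.assoc k k k P P P).toAlgHom.comp
      ((Algebra.TensorProduct.map hP.comulHom (.id k P)).comp hP.comulHom)
      = (Algebra.TensorProduct.map (.id k P) hP.comulHom).comp hP.comulHom := by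
  have hinj : Function.Injective (Algebra.TensorProduct.map P.val (tensorVal P)) :=
    TensorProduct.map_injective_of_flat_flat P.val.toLinearMap (tensorVal P).toLinearMap
      Subtype.val_injective (tensorVal_injective P)
  have h1 : ∀ s : (P ⊗[k] P) ⊗[k] P, Algebra.TensorProduct.map P.val (tensorVal P)
      (Algebra.TensorProduct.assoc k k k P P P s) =
      TensorProduct.assoc k H H H (Algebra.TensorProduct.map (tensorVal P) P.val s) := by
    intro s
    induction s with
    | zero => simp only [map_zero]
    | add a b ha hb => simp only [map_add, ha, hb]
    | tmul a b =>
      induction a with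
      | zero => simp only [TensorProduct.zero_tmul, map_zero]
      | add c d hc hd => simp only [TensorProduct.add_tmul, map_add, hc, hd]
      | tmul c d => rfl
  have h2 : ∀ t : P ⊗[k] P, Algebra.TensorProduct.map (tensorVal P) P.val
      (Algebra.TensorProduct.map hP.comulHom (.id k P) t) =
      (Coalgebra.comul (R := k) (A := H)).rTensor H (tensorVal P t) := by
    intro t
    induction t with
    | zero => simp only [map_zero]
    | add a b ha hb => simp only [map_add, ha, hb]
    | tmul a b => exact congrArg (· ⊗ₜ[k] (b : H)) (hP.tensorVal_comulHom a)
  have h3 : ∀ t : P ⊗[k] P, Algebra.TensorProduct.map P.val (tensorVal P)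
      (Algebra.TensorProduct.map (.id k P) hP.comulHom t) =
      (Coalgebra.comul (R := k) (A := H)).lTensor H (tensorVal P t) := by
    intro t
    induction t with
    | zero => simp only [map_zero]
    | add a b ha hb => simp only [map_add, ha, hb]
    | tmul a b => exact congrArg ((a : H) ⊗ₜ[k] ·) (hP.tensorVal_comulHom b)
  ext p
  apply hinj
  simp only [AlgHom.comp_apply]
  rw [h3, tensorVal_comulHom, ← Coalgebra.coassoc_apply, ← tensorVal_comulHom, ← h2]
  exact h1 _

theorem rTensor_counit :
    (Algebra.TensorProduct.map ((Bialgebra.counitAlgHom k H).comp P.val) (.id k P)).comp hP.comulHom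
      = (Algebra.TensorProduct.lid k P).symm := by
  have hinj : Function.Injective (Algebra.TensorProduct.map (.id k k) P.val) :=
    TensorProduct.map_injective_of_flat_flat (.id : k →ₗ[k] k) P.val.toLinearMap
      Function.injective_id Subtype.val_injective
  have h2 : ∀ t : P ⊗[k] P, Algebra.TensorProduct.map (.id k k) P.val
      (Algebra.TensorProduct.map ((Bialgebra.counitAlgHom k H).comp P.val) (.id k P) t) =
      (Coalgebra.counit (R := k) (A := H)).rTensor H (tensorVal P t) := by
    intro t
    induction t with
    | zero => simp only [map_zero]
    | add a b ha hb => simp only [map_add, ha, hb]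
    | tmul a b => simp [tensorVal]
  ext p
  apply hinj
  simp only [AlgHom.comp_apply]
  rw [h2, tensorVal_comulHom, Coalgebra.rTensor_counit_comul]
  simp

theorem lTensor_counit :
    (Algebra.TensorProduct.map (.id k P) ((Bialgebra.counitAlgHom k H).comp P.val)).comp hP.comulHom
      = (Algebra.TensorProduct.rid k k P).symm := by
  have hinj : Function.Injective (Algebra.TensorProduct.map P.val (.id k k)) :=
    TensorProduct.map_injective_of_flat_flat P.val.toLinearMap (.id : k →ₗ[k] k)
      Subtype.val_injective Function.injective_id
  have h2 : ∀ t : P ⊗[k] P, Algebra.TensorProduct.map P.val (.id k k)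
      (Algebra.TensorProduct.map (.id k P) ((Bialgebra.counitAlgHom k H).comp P.val) t) =
      (Coalgebra.counit (R := k) (A := H)).lTensor H (tensorVal P t) := by
    intro t
    induction t with
    | zero => simp only [map_zero]
    | add a b ha hb => simp only [map_add, ha, hb]
    | tmul a b => simp [tensorVal]
  ext p
  apply hinj
  simp only [AlgHom.comp_apply]
  rw [h2, tensorVal_comulHom, Coalgebra.lTensor_counit_comul]
  simp

/-- The bialgebra structure of a Hopf subalgebra: all operations are restricted. -/
abbrev bialgebra : Bialgebra k P :=
  Bialgebra.ofAlgHom hP.comulHom ((Bialgebra.counitAlgHom k H).comp P.val)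
    hP.coassoc hP.rTensor_counit hP.lTensor_counit

/-- The Hopf algebra structure of a Hopf subalgebra: all operations are restricted. -/
abbrev hopfAlgebra : HopfAlgebra k P where
  toBialgebra := hP.bialgebra
  antipode := hP.antipodeMap
  mul_antipode_rTensor_comul := by
    have h2 : ∀ t : P ⊗[k] P, ((LinearMap.mul' k P (hP.antipodeMap.rTensor P t) : P) : H) =
        LinearMap.mul' k H ((HopfAlgebra.antipode k (A := H)).rTensor H (tensorVal P t)) := by
      intro t
      induction t with
      | zero => simp only [map_zero, ZeroMemClass.coe_zero]
      | add a b ha hb => simp only [map_add, AddMemClass.coe_add, ha, hb]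
      | tmul a b => rfl
    ext p
    refine (h2 (hP.comulHom p)).trans ?_
    rw [tensorVal_comulHom, HopfAlgebra.mul_antipode_rTensor_comul_apply]
    rfl
  mul_antipode_lTensor_comul := by
    have h2 : ∀ t : P ⊗[k] P, ((LinearMap.mul' k P (hP.antipodeMap.lTensor P t) : P) : H) =
        LinearMap.mul' k H ((HopfAlgebra.antipode k (A := H)).lTensor H (tensorVal P t)) := by
      intro t
      induction t with
      | zero => simp only [map_zero, ZeroMemClass.coe_zero]
      | add a b ha hb => simp only [map_add, AddMemClass.coe_add, ha, hb]
      | tmul a b => rfl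
    ext p
    refine (h2 (hP.comulHom p)).trans ?_
    rw [tensorVal_comulHom, HopfAlgebra.mul_antipode_lTensor_comul_apply]
    rfl

end IsHopfSubalgebra
end HopfSubalgebra

section SOq3

variable {k : Type u} [Field k]

/-- `SO_q(3)`: the subalgebra of expressions of even degree in the generators of `SU_q(2)`. -/
def SOq3 (q : kˣ) : Subalgebra k (SUq2 q) :=
  Algebra.adjoin k {x | ∃ g h : Gen, x = SUq2.gen q g * SUq2.gen q h}

namespace SOq3

theorem gen_mul_gen_mem (q : kˣ) (g h : Gen) : SUq2.gen q g * SUq2.gen q h ∈ SOq3 q :=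
  Algebra.subset_adjoin ⟨g, h, rfl⟩

theorem comul_gen (q : kˣ) (g : Gen) : ∃ a b c d : Gen, Coalgebra.comul (R := k) (SUq2.gen q g) =
    SUq2.gen q a ⊗ₜ[k] SUq2.gen q b + SUq2.gen q c ⊗ₜ[k] SUq2.gen q d := by
  rcases g with _ | _ | _ | _
  · exact ⟨.α, .α, .β, .γ, SUq2.comul_α q⟩
  · exact ⟨.α, .β, .β, .δ, SUq2.comul_β q⟩
  · exact ⟨.γ, .α, .δ, .γ, SUq2.comul_γ q⟩
  · exact ⟨.γ, .β, .δ, .δ, SUq2.comul_δ q⟩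

theorem antipode_gen (q : kˣ) (g : Gen) : ∃ (r : k) (a : Gen),
    HopfAlgebra.antipode k (SUq2.gen q g) = r • SUq2.gen q a := by
  rcases g with _ | _ | _ | _
  · exact ⟨1, .δ, (SUq2.antipode_α q).trans (one_smul _ _).symm⟩
  · exact ⟨_, .β, SUq2.antipode_β q⟩
  · exact ⟨_, .γ, SUq2.antipode_γ q⟩
  · exact ⟨1, .α, (SUq2.antipode_δ q).trans (one_smul _ _).symm⟩

theorem isHopfSubalgebra (q : kˣ) : IsHopfSubalgebra (SOq3 q) where
  comul_mem p hp := by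
    induction hp using Algebra.adjoin_induction with
    | mem x hx =>
      obtain ⟨g, h, rfl⟩ := hx
      obtain ⟨a, b, c, d, h1⟩ := comul_gen q g
      obtain ⟨a', b', c', d', h2⟩ := comul_gen q h
      have key : ∀ x y z w : Gen, (SUq2.gen q x * SUq2.gen q y) ⊗ₜ[k]
          (SUq2.gen q z * SUq2.gen q w) ∈ (tensorVal (SOq3 q)).range := fun x y z w =>
        ⟨⟨_, gen_mul_gen_mem q x y⟩ ⊗ₜ[k] ⟨_, gen_mul_gen_mem q z w⟩, rfl⟩
      rw [Bialgebra.comul_mul, h1, h2]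
      simp only [mul_add, add_mul, Algebra.TensorProduct.tmul_mul_tmul]
      exact add_mem (add_mem (key _ _ _ _) (key _ _ _ _))
        (add_mem (key _ _ _ _) (key _ _ _ _))
    | algebraMap r =>
      rw [Bialgebra.comul_algebraMap]
      exact Subalgebra.algebraMap_mem _ r
    | add a b _ _ ha hb =>
      rw [map_add]
      exact add_mem ha hb
    | mul a b _ _ ha hb =>
      rw [Bialgebra.comul_mul]
      exact mul_mem ha hb
  antipode_mem p hp := by
    induction hp using Algebra.adjoin_induction with
    | mem x hx =>
      obtain ⟨g, h, rfl⟩ := hx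
      obtain ⟨r, a, h1⟩ := antipode_gen q g
      obtain ⟨r', a', h2⟩ := antipode_gen q h
      rw [HopfAlgebra.antipode_mul_antidistrib, h1, h2, smul_mul_smul_comm]
      exact Subalgebra.smul_mem _ (gen_mul_gen_mem q _ _) _
    | algebraMap r =>
      rw [Algebra.algebraMap_eq_smul_one, map_smul, HopfAlgebra.antipode_one]
      exact Subalgebra.smul_mem _ (one_mem _) _
    | add a b _ _ ha hb =>
      rw [map_add]
      exact add_mem ha hb
    | mul a b _ _ ha hb =>
      rw [HopfAlgebra.antipode_mul_antidistrib]
      exact mul_mem hb ha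

/-- The Hopf algebra structure of `SO_q(3)`, restricted from `SU_q(2)`. -/
instance (q : kˣ) : HopfAlgebra k (SOq3 q) := (isHopfSubalgebra q).hopfAlgebra

end SOq3
end SOq3

section Monopole

open LaurentPolynomial

variable {k : Type u} [Field k]

namespace SUq2

theorem torus_rel (q : kˣ) : IsQuantumMatrix q (T 1 : k[T;T⁻¹]) 0 0 (T (-1)) := by
  constructor <;> simp only [mul_zero, zero_mul, smul_zero, add_zero, sub_zero]
  · exact mul_comm _ _
  · rw [← T_add]
    exact T_zero

/-- The projection of `SU_q(2)` to the diagonal torus with coordinate `Z^{1/2}` (here `T`):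
`α ↦ Z^{1/2}`, `δ ↦ Z^{-1/2}`, `β, γ ↦ 0`. -/
def toTorus (q : kˣ) : SUq2 q →ₐ[k] k[T;T⁻¹] := lift (torus_rel q)

theorem toTorus_α (q : kˣ) : toTorus q (α q) = T 1 := lift_α (torus_rel q)
theorem toTorus_β (q : kˣ) : toTorus q (β q) = 0 := lift_β (torus_rel q)
theorem toTorus_γ (q : kˣ) : toTorus q (γ q) = 0 := lift_γ (torus_rel q)
theorem toTorus_δ (q : kˣ) : toTorus q (δ q) = T (-1) := lift_δ (torus_rel q)

theorem counit_torus (n : ℤ) : Coalgebra.counit (R := k) (T n : k[T;T⁻¹]) = 1 := by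
  simp

theorem counit_toTorus (q : kˣ) (x : SUq2 q) :
    Coalgebra.counit (R := k) (toTorus q x) = Coalgebra.counit (R := k) x := by
  have : (Bialgebra.counitAlgHom k k[T;T⁻¹]).comp (toTorus q) =
      Bialgebra.counitAlgHom k (SUq2 q) := by
    apply hom_ext' <;> simp only [AlgHom.comp_apply, Bialgebra.counitAlgHom_apply, toTorus_α,
      toTorus_β, toTorus_γ, toTorus_δ, counit_α, counit_β, counit_γ, counit_δ, counit_torus, map_zero]
  exact DFunLike.congr_fun this x

theorem comul_toTorus (q : kˣ) (x : SUq2 q) : Coalgebra.comul (R := k) (toTorus q x) =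
    Algebra.TensorProduct.map (toTorus q) (toTorus q) (Coalgebra.comul (R := k) x) := by
  have : (Bialgebra.comulAlgHom k k[T;T⁻¹]).comp (toTorus q) =
      (Algebra.TensorProduct.map (toTorus q) (toTorus q)).comp
        (Bialgebra.comulAlgHom k (SUq2 q)) := by
    apply hom_ext' <;> simp [toTorus_α, toTorus_β, toTorus_γ, toTorus_δ, comul_α, comul_β,
      comul_γ, comul_δ]
  exact DFunLike.congr_fun this x

/-- The six generators of the ideal of the 3D calculus on `SU_q(2)`. -/
def calculusGenerators (q : kˣ) : Set (SUq2 q) :=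
  {δ q + (q : k) ^ 2 • α q - algebraMap k _ (1 + (q : k) ^ 2), γ q ^ 2, β q * γ q, β q ^ 2,
    (α q - 1) * γ q, (α q - 1) * β q}

end SUq2

/-- The inclusion `k[Z, Z⁻¹] → k[Z^{1/2}, Z^{-1/2}]`, `Z ↦ (Z^{1/2})²`. -/
def squareMap (k : Type u) [Field k] : k[T;T⁻¹] →ₐc[k] k[T;T⁻¹] :=
  AddMonoidAlgebra.mapDomainBialgHom k (AddMonoidHom.mulLeft (2 : ℤ))

theorem squareMap_T (n : ℤ) : squareMap k (T n) = T (2 * n) := by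
  unfold T
  exact AddMonoidAlgebra.mapDomainBialgHom_single _ _ _

theorem squareMap_injective : Function.Injective (squareMap k) := by
  have : Function.Injective (AddMonoidHom.mulLeft (2 : ℤ)) :=
    mul_right_injective₀ (two_ne_zero)
  exact AddMonoidAlgebra.mapDomain_injective this

namespace SOq3

theorem toTorus_mem (q : kˣ) (p : SOq3 q) :
    SUq2.toTorus q p ∈ (squareMap k : k[T;T⁻¹] →ₐ[k] k[T;T⁻¹]).range := by
  obtain ⟨p, hp⟩ := p
  induction hp using Algebra.adjoin_induction with
  | mem x hx =>
    obtain ⟨g, h, rfl⟩ := hx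
    have key : ∀ n : ℤ, T (2 * n) ∈ (squareMap k : k[T;T⁻¹] →ₐ[k] k[T;T⁻¹]).range :=
      fun n => ⟨T n, squareMap_T n⟩
    have h0 : ∀ g : Gen, SUq2.toTorus q (SUq2.gen q g) = 0 ∨
        SUq2.toTorus q (SUq2.gen q g) = T 1 ∨ SUq2.toTorus q (SUq2.gen q g) = T (-1) := by
      rintro (_ | _ | _ | _)
      · exact .inr (.inl (SUq2.toTorus_α q))
      · exact .inl (SUq2.toTorus_β q)
      · exact .inl (SUq2.toTorus_γ q)
      · exact .inr (.inr (SUq2.toTorus_δ q))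
    change SUq2.toTorus q (SUq2.gen q g * SUq2.gen q h) ∈ _
    rw [map_mul]
    rcases h0 g with h1 | h1 | h1 <;> rcases h0 h with h2 | h2 | h2 <;> rw [h1, h2] <;>
      simp only [zero_mul, mul_zero, ← T_add] <;>
      first
        | exact zero_mem _
        | exact key 1
        | exact key 0
        | exact key (-1)
  | algebraMap r =>
    change SUq2.toTorus q (algebraMap k _ r) ∈ _
    rw [AlgHom.commutes]
    exact Subalgebra.algebraMap_mem _ r
  | add a b _ _ ha hb =>
    change SUq2.toTorus q (a + b) ∈ _
    rw [map_add]
    exact add_mem ha hb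
  | mul a b _ _ ha hb =>
    change SUq2.toTorus q (a * b) ∈ _
    rw [map_mul]
    exact mul_mem ha hb

/-- The restriction of `SU_q(2) → k[Z^{1/2}, Z^{-1/2}]` to `SO_q(3) → k[Z, Z⁻¹]`, as an algebra
map. -/
def projAlg (q : kˣ) : SOq3 q →ₐ[k] k[T;T⁻¹] :=
  (AlgEquiv.ofInjective (squareMap k : k[T;T⁻¹] →ₐ[k] k[T;T⁻¹])
    squareMap_injective).symm.toAlgHom.comp
    (((SUq2.toTorus q).comp (SOq3 q).val).codRestrict _ (toTorus_mem q))

theorem squareMap_projAlg (q : kˣ) (p : SOq3 q) :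
    squareMap k (projAlg q p) = SUq2.toTorus q p :=
  congrArg Subtype.val ((AlgEquiv.ofInjective (squareMap k : k[T;T⁻¹] →ₐ[k] k[T;T⁻¹])
    squareMap_injective).apply_symm_apply ⟨_, toTorus_mem q p⟩)

/-- The Hopf algebra projection `π : SO_q(3) → k[Z, Z⁻¹]`, where `Z` is the variable `T` of
Mathlib's Laurent polynomials. -/
def proj (q : kˣ) : SOq3 q →ₐc[k] k[T;T⁻¹] :=
  BialgHom.ofAlgHom (projAlg q)
    (by
      ext p
      change Coalgebra.counit (R := k) (projAlg q p) = Coalgebra.counit (R := k) (p : SUq2 q)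
      rw [← SUq2.counit_toTorus, ← squareMap_projAlg]
      exact (CoalgHomClass.counit_comp_apply (squareMap k) _).symm)
    (by
      have hinj : Function.Injective (TensorProduct.map (squareMap k : k[T;T⁻¹] →ₗ[k] k[T;T⁻¹])
          (squareMap k : k[T;T⁻¹] →ₗ[k] k[T;T⁻¹])) :=
        TensorProduct.map_injective_of_flat_flat _ _ squareMap_injective squareMap_injective
      have h1 : ∀ t : SOq3 q ⊗[k] SOq3 q,
          TensorProduct.map (squareMap k : k[T;T⁻¹] →ₗ[k] k[T;T⁻¹])
            (squareMap k : k[T;T⁻¹] →ₗ[k] k[T;T⁻¹])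
            (Algebra.TensorProduct.map (projAlg q) (projAlg q) t) =
          Algebra.TensorProduct.map (SUq2.toTorus q) (SUq2.toTorus q) (tensorVal (SOq3 q) t) := by
        intro t
        induction t with
        | zero => simp only [map_zero]
        | add a b ha hb => simp only [map_add, ha, hb]
        | tmul a b =>
          exact congrArg₂ (· ⊗ₜ[k] ·) (squareMap_projAlg q a) (squareMap_projAlg q b)
      ext p
      apply hinj
      refine (h1 _).trans ?_
      refine (congrArg _ ((isHopfSubalgebra q).tensorVal_comulHom p)).trans ?_
      rw [← SUq2.comul_toTorus, ← squareMap_projAlg]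
      exact (CoalgHomClass.map_comp_comul_apply (squareMap k) _).symm)

/-- The right ideal `M_P` of the calculus on `SO_q(3)` inherited from the 3D calculus on
`SU_q(2)`: the restriction to `SO_q(3)` of the right ideal of `SU_q(2)` with six generators. -/
def idealP (q : kˣ) : Submodule k (SOq3 q) :=
  (rightIdealSpan k (SUq2.calculusGenerators q)).comap (SOq3 q).val.toLinearMap

/-- The induced ideal `M_A = π(M_P)` of `k[Z, Z⁻¹]`. -/
def idealA (q : kˣ) : Submodule k k[T;T⁻¹] :=
  (idealP q).map (proj q : SOq3 q →ₗ[k] k[T;T⁻¹])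

/-- The quantum sphere `S_q²`: the subalgebra of `SO_q(3)` generated by `b₋ = αβ`, `b₊ = γδ` and
`b₃ = αδ`. -/
def sphere (q : kˣ) : Subalgebra k (SOq3 q) :=
  Algebra.adjoin k {⟨SUq2.α q * SUq2.β q, gen_mul_gen_mem q _ _⟩,
    ⟨SUq2.γ q * SUq2.δ q, gen_mul_gen_mem q _ _⟩, ⟨SUq2.α q * SUq2.δ q, gen_mul_gen_mem q _ _⟩}

end SOq3
end Monopole

end

end QuantumBundle

open QuantumBundle LaurentPolynomial

/-! The third claim follows from the first by a general criterion for Hopf algebra surjections `π :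
P → A`. The map `kappa` is inverse to `u ⊗ v ↦ u v₍₁₎ ⊗ v₍₂₎` (`tildeMap_comul_kappa`,
`kappa_tildeMap_comul`) and turns `tildeMap (pushCoaction π)` into `id ⊗ π` (`tildeMap_kappa`). So
the kernel of `tildeMap` is `κ(P ⊗ ker π)`. By exactness of `π` it is spanned by elements `κ(a ⊗ b
p)` with `b` coinvariant and `π b = 0`. These are horizontal, because `S(b₍₁₎) ⊗ b₍₂₎` lies in `P ⊗
B` and has product `ε(b) = 0`. Since `M_A = π(M_P)`, `tildeMap` carries `N_P` onto `P ⊗ M_A`, and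
exactness passes to the quotient by `N_P`. Covariance of `N_P` is the `Ad`-condition on `M_P`
rewritten through `kappa` (`tildeMap_coactionForms`).

For `SU_q(2)` the computations use no monomial basis; they close subspaces under multiplication by
generators. Base: with `V₊ = ⟨α, γ⟩`, `V₋ = ⟨β, δ⟩` and `B` the sphere, `V₊ V₋ = V₋ V₊ ⊆ B` and `V±
B ⊆ B V±`. So the projection of any element to weight `n` lies in `B V±^|n|`, and weight zero gives
`B` (`coinvariants_toTorusBialg`). Exactness: the kernel of the torus projection is `β H + γ H` with
`H = SU_q(2)`. For an even element the coefficients can be chosen odd, as `2` is invertible.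
Inserting the determinant relation after `β` and `γ` then exhibits factors in `B ∩ ker π`
(`isExactProjection_proj`). `Ad`-invariance: the torus adjoint coaction is an algebra map and every
generator of `M` is homogeneous for it (`torusAd_mem`).

For `M_A`, put `X = δ + q² α` and `c = 1 + q²`. Modulo `β γ`, `(X - c)(X + c)` is `δ² + q⁴ α² - (1 +
q⁴)`, so the stated generator `g` is in `M_A`. Modulo `g` every Laurent polynomial is some `a + b
Z`. If this lies in `M_A`, then `a + b T²` is a multiple of `T⁻¹ + q² T - (1 + q²)` in `T =
Z^{1/2}`. Evaluation at a companion matrix forces `a = b = 0` when `q² ≠ -1`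
(`eq_zero_of_mem_idealA`). -/

namespace QuantumBundle

section HomogeneousBundles

variable {k : Type*} [Field k] {P : Type*} {A : Type*} [Ring P] [Ring A]

/-! ### The map `tildeMap` of a comodule algebra, and horizontal forms -/

section Coaction

variable [Algebra k P] [HopfAlgebra k A]

/-- Exactness of `V ⊗ -` over a field; membership becomes a vanishing statement in a quotient, which
injective maps reflect. -/
theorem mem_tensorLeft_iff {V W : Type*} [AddCommGroup V] [Module k V] [AddCommGroup W]
    [Module k W] {N : Submodule k W} {x : V ⊗[k] W} :
    x ∈ tensorLeft V N ↔ N.mkQ.lTensor V x = 0 :=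
  ((Module.Flat.lTensor_exact V (LinearMap.exact_subtype_mkQ N)) x).symm

theorem mem_tensorRight_iff {V W : Type*} [AddCommGroup V] [Module k V] [AddCommGroup W]
    [Module k W] {N : Submodule k V} {x : V ⊗[k] W} :
    x ∈ tensorRight N W ↔ N.mkQ.rTensor W x = 0 :=
  ((Module.Flat.rTensor_exact W (LinearMap.exact_subtype_mkQ N)) x).symm

theorem tmul_mem_tensorLeft {V W : Type*} [AddCommGroup V] [Module k V] [AddCommGroup W]
    [Module k W] {N : Submodule k W} (v : V) {w : W} (hw : w ∈ N) :
    v ⊗ₜ[k] w ∈ tensorLeft V N :=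
  ⟨v ⊗ₜ ⟨w, hw⟩, rfl⟩

theorem tmul_mem_tensorRight {V W : Type*} [AddCommGroup V] [Module k V] [AddCommGroup W]
    [Module k W] {N : Submodule k V} {v : V} (hv : v ∈ N) (w : W) :
    v ⊗ₜ[k] w ∈ tensorRight N W :=
  ⟨⟨v, hv⟩ ⊗ₜ w, rfl⟩

/-- Induction for elements of `V ⊗ N`. -/
theorem tensorLeft_le {V W : Type*} [AddCommGroup V] [Module k V] [AddCommGroup W]
    [Module k W] {N : Submodule k W} {K : Submodule k (V ⊗[k] W)}
    (h : ∀ v, ∀ w ∈ N, v ⊗ₜ[k] w ∈ K) : tensorLeft V N ≤ K := by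
  rintro _ ⟨y, rfl⟩
  induction y with
  | zero => simp
  | add a b ha hb => rw [map_add]; exact add_mem ha hb
  | tmul v w => exact h v w w.2

theorem tensorRight_le {V W : Type*} [AddCommGroup V] [Module k V] [AddCommGroup W]
    [Module k W] {N : Submodule k V} {K : Submodule k (V ⊗[k] W)}
    (h : ∀ v ∈ N, ∀ w, v ⊗ₜ[k] w ∈ K) : tensorRight N W ≤ K := by
  rintro _ ⟨y, rfl⟩
  induction y with
  | zero => simp
  | add a b ha hb => rw [map_add]; exact add_mem ha hb
  | tmul v w => exact h v v.2 w

theorem tildeMap_tmul (ρ : P →ₐ[k] P ⊗[k] A) (u v : P) :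
    tildeMap ρ (u ⊗ₜ v) = (u ⊗ₜ[k] 1) * ρ v := by
  change (LinearMap.mul' k P).rTensor A ((TensorProduct.assoc k P P A).symm (u ⊗ₜ ρ v)) = _
  generalize ρ v = t
  induction t with
  | zero => simp
  | add a b ha hb => simp only [TensorProduct.tmul_add, map_add, mul_add, ha, hb]
  | tmul a b => simp

theorem bimulForms_tmul (u v a b : P) :
    bimulForms (k := k) u v (a ⊗ₜ b) = (u * a) ⊗ₜ[k] (b * v) := rfl

theorem tildeMap_bimulForms (ρ : P →ₐ[k] P ⊗[k] A) (u v : P) (x : P ⊗[k] P) :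
    tildeMap ρ (bimulForms u v x) = (u ⊗ₜ[k] 1) * tildeMap ρ x * ρ v := by
  induction x with
  | zero => simp
  | add a b ha hb => simp only [map_add, mul_add, add_mul, ha, hb]
  | tmul a b =>
    rw [bimulForms_tmul, tildeMap_tmul, tildeMap_tmul, map_mul, ← mul_assoc, ← mul_assoc]
    simp

theorem bimulForms_mem_universalHorizontal {B : Subalgebra k P} (u v : P) {x : P ⊗[k] P}
    (hx : x ∈ universalHorizontal B) : bimulForms u v x ∈ universalHorizontal B := by
  induction hx using Submodule.span_induction with
  | zero => simp
  | add a b _ _ ha hb => rw [map_add]; exact add_mem ha hb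
  | smul r a _ ha => rw [map_smul]; exact Submodule.smul_mem _ _ ha
  | mem x hx =>
    obtain ⟨u', v', w, hw, rfl⟩ := hx
    refine Submodule.subset_span ⟨u * u', v' * v, w, hw, ?_⟩
    generalize TensorProduct.map B.val.toLinearMap B.val.toLinearMap w = t
    induction t with
    | zero => simp
    | add a b ha hb => simp only [map_add, ha, hb]
    | tmul a b => simp [bimulForms_tmul, mul_assoc]

/-- A one-form in `P ⊗ B` is horizontal. -/
theorem map_val_mem_universalHorizontal {B : Subalgebra k P} (z : P ⊗[k] B)
    (hz : LinearMap.mul' k P (B.val.toLinearMap.lTensor P z) = 0) :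
    B.val.toLinearMap.lTensor P z ∈ universalHorizontal B := by
  -- `x ⊗ b` differs from `x b ⊗ 1` by `x · (1 ⊗ b - b ⊗ 1)`, a left multiple of a universal form of
  -- `B`. If the product vanishes, the terms `x b ⊗ 1` cancel.
  have key : ∀ z : P ⊗[k] B, B.val.toLinearMap.lTensor P z -
      (LinearMap.mul' k P (B.val.toLinearMap.lTensor P z)) ⊗ₜ[k] 1 ∈ universalHorizontal B := by
    intro z
    induction z with
    | zero => simp
    | add a b ha hb =>
      simp only [map_add, TensorProduct.add_tmul]
      rw [add_sub_add_comm]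
      exact add_mem ha hb
    | tmul x b =>
      refine Submodule.subset_span ⟨x, 1, 1 ⊗ₜ b - b ⊗ₜ 1, ?_, ?_⟩
      · simp [universalForms]
      · simp [bimulForms_tmul]
  simpa [hz] using key z

/-- On `B ⊗ B` the coaction is trivial, so `tildeMap` is the product followed by `· ⊗ 1` and kills
`B²`; multiplication by `P` on either side preserves this. -/
theorem universalHorizontal_le_ker_tildeMap {ρ : P →ₐ[k] P ⊗[k] A} {B : Subalgebra k P}
    (hB : B ≤ coinvariants ρ) : universalHorizontal B ≤ LinearMap.ker (tildeMap ρ) := by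
  refine Submodule.span_le.2 ?_
  rintro _ ⟨u, v, w, hw, rfl⟩
  have key : ∀ w : B ⊗[k] B, tildeMap ρ
      (TensorProduct.map B.val.toLinearMap B.val.toLinearMap w) =
      ((LinearMap.mul' k B w : B) : P) ⊗ₜ[k] 1 := by
    intro w
    induction w with
    | zero => simp
    | add a b ha hb => simp only [map_add, ha, hb, AddMemClass.coe_add, TensorProduct.add_tmul]
    | tmul a b =>
      have hb : ρ b = (b : P) ⊗ₜ 1 := hB b.2
      simp [tildeMap_tmul, hb]
  have hw' : LinearMap.mul' k B w = 0 := hw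
  change tildeMap ρ _ = 0
  rw [tildeMap_bimulForms, key, hw']
  simp

end Coaction

/-! ### The isomorphism `kappa`, coinvariants, and the kernel of `tildeMap` -/

section Hopf

variable [HopfAlgebra k P] [HopfAlgebra k A]

theorem pushCoaction_apply (π : P →ₐc[k] A) (u : P) :
    pushCoaction π u = (π : P →ₗ[k] A).lTensor P (Coalgebra.comul (R := k) u) := rfl

theorem kappa_tmul (a m : P) : kappa k P (a ⊗ₜ m) =
    bimulForms a 1 ((HopfAlgebra.antipode k (A := P)).rTensor P (Coalgebra.comul (R := k) m)) := by
  change (LinearMap.mul' k P).rTensor P ((TensorProduct.assoc k P P P).symm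
    (a ⊗ₜ (HopfAlgebra.antipode k (A := P)).rTensor P (Coalgebra.comul (R := k) m))) = _
  generalize (HopfAlgebra.antipode k (A := P)).rTensor P (Coalgebra.comul (R := k) m) = t
  induction t with
  | zero => simp
  | add a b ha hb => simp only [TensorProduct.tmul_add, map_add, ha, hb]
  | tmul a b => simp [bimulForms_tmul]

/-- The computation is `S(m₍₁₎) m₍₂₎ ⊗ π(m₍₃₎) = 1 ⊗ π(m)`: coassociativity brings the first two
legs together and the antipode axiom collapses them. -/
theorem tildeMap_antipode_comul (π : P →ₐc[k] A) (m : P) : tildeMap (pushCoaction π)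
    ((HopfAlgebra.antipode k (A := P)).rTensor P (Coalgebra.comul (R := k) m)) =
      1 ⊗ₜ[k] π m := by
  have h1 : ∀ t : P ⊗[k] P, tildeMap (pushCoaction π) ((HopfAlgebra.antipode k).rTensor P t) =
      TensorProduct.map (LinearMap.mul' k P ∘ₗ (HopfAlgebra.antipode k).rTensor P)
        (π : P →ₗ[k] A) ((TensorProduct.assoc k P P P).symm
          ((Coalgebra.comul (R := k)).lTensor P t)) := by
    intro t
    induction t with
    | zero => simp
    | add a b ha hb => simp only [map_add, ha, hb]
    | tmul x y =>
      rw [LinearMap.rTensor_tmul, tildeMap_tmul, pushCoaction_apply, LinearMap.lTensor_tmul]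
      generalize Coalgebra.comul (R := k) y = s
      induction s with
      | zero => simp
      | add a b ha hb => simp only [map_add, mul_add, TensorProduct.tmul_add, ha, hb]
      | tmul a b => simp
  rw [h1, Coalgebra.coassoc_symm_apply]
  have h2 : ∀ t : P ⊗[k] P, TensorProduct.map
      (LinearMap.mul' k P ∘ₗ (HopfAlgebra.antipode k).rTensor P) (π : P →ₗ[k] A)
        ((Coalgebra.comul (R := k)).rTensor P t) =
      TensorProduct.map (Algebra.linearMap k P) (π : P →ₗ[k] A)
        ((Coalgebra.counit (R := k)).rTensor P t) := by
    intro t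
    induction t with
    | zero => simp
    | add a b ha hb => simp only [map_add, ha, hb]
    | tmul x y =>
      simp [HopfAlgebra.mul_antipode_rTensor_comul_apply]
  rw [h2, Coalgebra.rTensor_counit_comul]
  simp

/-- The identity behind the criterion: in the coordinates given by `kappa`, surjectivity, kernel and
compatibility of `tildeMap` are all read off from `id ⊗ π`. -/
theorem tildeMap_kappa (π : P →ₐc[k] A) (x : P ⊗[k] P) :
    tildeMap (pushCoaction π) (kappa k P x) = (π : P →ₗ[k] A).lTensor P x := by
  induction x with
  | zero => simp
  | add a b ha hb => simp only [map_add, ha, hb]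
  | tmul a m =>
    rw [kappa_tmul, tildeMap_bimulForms, tildeMap_antipode_comul]
    simp

/-- The case `π = id` of `tildeMap_kappa`, since the coaction of `P` on itself is `Δ`. -/
theorem tildeMap_comul_kappa (x : P ⊗[k] P) :
    tildeMap (Bialgebra.comulAlgHom k P) (kappa k P x) = x := by
  have h : pushCoaction (BialgHom.id k P) = Bialgebra.comulAlgHom k P := by
    ext u
    rw [pushCoaction_apply]
    exact LinearMap.congr_fun (LinearMap.lTensor_id P P) _
  rw [← h, tildeMap_kappa]
  exact LinearMap.congr_fun (LinearMap.lTensor_id P P) _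

theorem kappa_mul_left (u : P) (x : P ⊗[k] P) :
    kappa k P ((u ⊗ₜ[k] 1) * x) = (u ⊗ₜ[k] 1) * kappa k P x := by
  induction x with
  | zero => simp
  | add a b ha hb => simp only [map_add, mul_add, ha, hb]
  | tmul a m =>
    rw [Algebra.TensorProduct.tmul_mul_tmul, kappa_tmul, kappa_tmul, one_mul]
    generalize (HopfAlgebra.antipode k (A := P)).rTensor P (Coalgebra.comul (R := k) m) = t
    induction t with
    | zero => simp
    | add a b ha hb => simp only [map_add, mul_add, ha, hb]
    | tmul a b => simp [bimulForms_tmul, mul_assoc]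

/-- The other antipode axiom, `v₍₁₎ S(v₍₂₎) ⊗ v₍₃₎ = 1 ⊗ v`; it gives the second half of the
bijectivity of `kappa`. -/
theorem kappa_comul (v : P) : kappa k P (Coalgebra.comul (R := k) v) = 1 ⊗ₜ[k] v := by
  have h1 : ∀ t : P ⊗[k] P, kappa k P t = (LinearMap.mul' k P ∘ₗ
      (HopfAlgebra.antipode k).lTensor P).rTensor P ((TensorProduct.assoc k P P P).symm
          ((Coalgebra.comul (R := k)).lTensor P t)) := by
    intro t
    induction t with
    | zero => simp
    | add a b ha hb => simp only [map_add, ha, hb]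
    | tmul x y =>
      rw [kappa_tmul, LinearMap.lTensor_tmul]
      generalize Coalgebra.comul (R := k) y = s
      induction s with
      | zero => simp
      | add a b ha hb => simp only [map_add, TensorProduct.tmul_add, ha, hb]
      | tmul a b => simp [bimulForms_tmul]
  rw [h1, Coalgebra.coassoc_symm_apply]
  have h2 : ∀ t : P ⊗[k] P, (LinearMap.mul' k P ∘ₗ (HopfAlgebra.antipode k).lTensor P).rTensor P
        ((Coalgebra.comul (R := k)).rTensor P t) =
      (Algebra.linearMap k P).rTensor P ((Coalgebra.counit (R := k)).rTensor P t) := by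
    intro t
    induction t with
    | zero => simp
    | add a b ha hb => simp only [map_add, ha, hb]
    | tmul x y => simp [HopfAlgebra.mul_antipode_lTensor_comul_apply]
  rw [h2, Coalgebra.rTensor_counit_comul]
  simp

theorem kappa_tildeMap_comul (x : P ⊗[k] P) :
    kappa k P (tildeMap (Bialgebra.comulAlgHom k P) x) = x := by
  induction x with
  | zero => simp
  | add a b ha hb => simp only [map_add, ha, hb]
  | tmul u v =>
    rw [tildeMap_tmul, kappa_mul_left, Bialgebra.comulAlgHom_apply, kappa_comul]
    simp

theorem mem_formsOfIdeal_iff {M : Submodule k P} {x : P ⊗[k] P} :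
    x ∈ formsOfIdeal M ↔ tildeMap (Bialgebra.comulAlgHom k P) x ∈ tensorLeft P M := by
  constructor
  · rintro ⟨y, hy, rfl⟩
    rwa [tildeMap_comul_kappa]
  · intro h
    exact ⟨_, h, kappa_tildeMap_comul x⟩

/-- The product of `κ(a ⊗ m)` is `a ε(m) = 0`. In the coordinates of `mem_formsOfIdeal_iff`, right
multiplication by `v` becomes right multiplication by `Δ v`, which preserves `P ⊗ M` because `M` is
a right ideal. -/
theorem isSubbimoduleOfForms_formsOfIdeal {M : Submodule k P} (hM : IsLeftCovariantIdeal M) :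
    IsSubbimoduleOfForms (formsOfIdeal M) where
  le := by
    refine Submodule.map_le_iff_le_comap.2 (tensorLeft_le fun a m hm => ?_)
    have hm' : Coalgebra.counit (R := k) m = 0 := hM.le_ker hm
    change LinearMap.mul' k P (kappa k P (a ⊗ₜ m)) = 0
    have key : ∀ t : P ⊗[k] P, LinearMap.mul' k P (bimulForms a 1 t) =
        a * LinearMap.mul' k P t := by
      intro t
      induction t with
      | zero => simp
      | add a b ha hb => simp only [map_add, mul_add, ha, hb]
      | tmul x y => simp [bimulForms_tmul, mul_assoc]
    rw [kappa_tmul, key, HopfAlgebra.mul_antipode_rTensor_comul_apply, hm']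
    simp
  bimul_mem u v x hx := by
    rw [mem_formsOfIdeal_iff] at hx ⊢
    rw [tildeMap_bimulForms]
    have key : ∀ y ∈ tensorLeft P M, ∀ s : P ⊗[k] P, (u ⊗ₜ[k] 1) * y * s ∈ tensorLeft P M := by
      intro y hy s
      induction s with
      | zero => simp
      | add a b ha hb => rw [mul_add]; exact add_mem ha hb
      | tmul p p' =>
        have : tensorLeft P M ≤ (tensorLeft P M).comap
            (LinearMap.mulRight k (p ⊗ₜ[k] p') ∘ₗ LinearMap.mulLeft k (u ⊗ₜ[k] (1 : P))) := by
          refine tensorLeft_le fun a m hm => ?_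
          change (u ⊗ₜ[k] 1) * (a ⊗ₜ[k] m) * (p ⊗ₜ[k] p') ∈ tensorLeft P M
          simp only [Algebra.TensorProduct.tmul_mul_tmul, one_mul]
          exact tmul_mem_tensorLeft _ (hM.rightIdeal m hm p')
        exact this hy
    exact key _ hx _

theorem isRightComoduleAlgebra_pushCoaction (π : P →ₐc[k] A) :
    IsRightComoduleAlgebra (pushCoaction π) where
  coassoc u := by
    have h1 : ∀ t : P ⊗[k] P, TensorProduct.assoc k P A A
        ((pushCoaction π).toLinearMap.rTensor A ((π : P →ₗ[k] A).lTensor P t)) =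
        (TensorProduct.map (π : P →ₗ[k] A) (π : P →ₗ[k] A)).lTensor P
          (TensorProduct.assoc k P P P ((Coalgebra.comul (R := k)).rTensor P t)) := by
      intro t
      induction t with
      | zero => simp
      | add a b ha hb => simp only [map_add, ha, hb]
      | tmul x y =>
        simp only [LinearMap.lTensor_tmul, LinearMap.rTensor_tmul, AlgHom.toLinearMap_apply,
          pushCoaction_apply]
        generalize Coalgebra.comul (R := k) x = s
        induction s with
        | zero => simp
        | add a b ha hb => simp only [map_add, TensorProduct.add_tmul, ha, hb]
        | tmul a b => simp
    rw [pushCoaction_apply, h1, Coalgebra.coassoc_apply]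
    generalize Coalgebra.comul (R := k) u = t
    induction t with
    | zero => simp
    | add a b ha hb => simp only [map_add, ha, hb]
    | tmul x y =>
      simp only [LinearMap.lTensor_tmul]
      congr 1
      exact CoalgHomClass.map_comp_comul_apply π y
  counit u := by
    rw [pushCoaction_apply, ← LinearMap.comp_apply, ← LinearMap.lTensor_comp]
    have : Coalgebra.counit (R := k) ∘ₗ (π : P →ₗ[k] A) = Coalgebra.counit :=
      CoalgHomClass.counit_comp π
    rw [this, Coalgebra.lTensor_counit_comul]

/-- The coinvariants form a left coideal: `Δ B ⊆ P ⊗ B`. -/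
theorem comul_mem_of_mem_coinvariants (π : P →ₐc[k] A) {b : P}
    (hb : b ∈ coinvariants (pushCoaction π)) : ∃ z : P ⊗[k] coinvariants (pushCoaction π),
      (coinvariants (pushCoaction π)).val.toLinearMap.lTensor P z =
        Coalgebra.comul (R := k) b := by
  set ρ := pushCoaction π
  -- `B` is the kernel of `D = ρ - (· ⊗ 1)`, so by flatness `P ⊗ B` is the kernel of `id ⊗ D`. What
  -- remains is `(id ⊗ ρ) Δ b = Δ b ⊗ 1`, which is coassociativity applied to `ρ b = b ⊗ 1`.
  let D : P →ₗ[k] P ⊗[k] A := ρ.toLinearMap -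
    (Algebra.TensorProduct.includeLeft : P →ₐ[k] P ⊗[k] A).toLinearMap
  have hex : Function.Exact (coinvariants ρ).val.toLinearMap D := by
    intro y
    simp only [D, LinearMap.sub_apply, sub_eq_zero]
    exact ⟨fun h => ⟨⟨y, h⟩, rfl⟩, by rintro ⟨⟨y, h⟩, rfl⟩; exact h⟩
  refine (Module.Flat.lTensor_exact P hex _).1 ?_
  have hb' : ρ b = b ⊗ₜ 1 := hb
  have h1 : ∀ t : P ⊗[k] P, ρ.toLinearMap.lTensor P t =
      ((π : P →ₗ[k] A).lTensor P).lTensor P ((Coalgebra.comul (R := k)).lTensor P t) := by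
    intro t
    rw [← LinearMap.comp_apply, ← LinearMap.lTensor_comp]
    rfl
  have h2 : ∀ t : P ⊗[k] P, ((π : P →ₗ[k] A).lTensor P).lTensor P
      (TensorProduct.assoc k P P P ((Coalgebra.comul (R := k)).rTensor P t)) =
      TensorProduct.assoc k P P A ((Coalgebra.comul (R := k)).rTensor A
        ((π : P →ₗ[k] A).lTensor P t)) := by
    intro t
    induction t with
    | zero => simp
    | add a b ha hb => simp only [map_add, ha, hb]
    | tmul x y =>
      simp only [LinearMap.lTensor_tmul, LinearMap.rTensor_tmul]
      generalize Coalgebra.comul (R := k) x = s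
      induction s with
      | zero => simp
      | add a b ha hb => simp only [map_add, TensorProduct.add_tmul, ha, hb]
      | tmul a b => simp
  have h3 : ∀ t : P ⊗[k] P, TensorProduct.assoc k P P A (t ⊗ₜ 1) =
      (Algebra.TensorProduct.includeLeft : P →ₐ[k] P ⊗[k] A).toLinearMap.lTensor P t := by
    intro t
    induction t with
    | zero => simp
    | add a b ha hb => simp only [map_add, TensorProduct.add_tmul, ha, hb]
    | tmul x y => simp
  rw [LinearMap.lTensor_sub, LinearMap.sub_apply, sub_eq_zero, h1, ← Coalgebra.coassoc_apply, h2,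
    ← pushCoaction_apply]
  change TensorProduct.assoc k P P A ((Coalgebra.comul (R := k)).rTensor A (ρ b)) = _
  rw [hb', LinearMap.rTensor_tmul, h3]

/-- Here `κ(a ⊗ b p) = a S(p₍₁₎) · (S(b₍₁₎) ⊗ b₍₂₎) · p₍₂₎`. The middle factor lies in `P ⊗ B` by
the coideal property and has product `ε(b) = ε(π b) = 0`, so it is horizontal. -/
theorem kappa_mul_mem_universalHorizontal (π : P →ₐc[k] A) (a p : P) {b : P}
    (hb : b ∈ coinvariants (pushCoaction π)) (hb0 : π b = 0) :
    kappa k P (a ⊗ₜ (b * p)) ∈ universalHorizontal (coinvariants (pushCoaction π)) := by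
  have hε : Coalgebra.counit (R := k) b = 0 := by
    have h := CoalgHomClass.counit_comp_apply π b
    rw [hb0, map_zero] at h
    exact h.symm
  have hdb : (HopfAlgebra.antipode k (A := P)).rTensor P (Coalgebra.comul (R := k) b) ∈
      universalHorizontal (coinvariants (pushCoaction π)) := by
    obtain ⟨z, hz⟩ := comul_mem_of_mem_coinvariants π hb
    have h1 : (HopfAlgebra.antipode k (A := P)).rTensor P (Coalgebra.comul (R := k) b) =
        (coinvariants (pushCoaction π)).val.toLinearMap.lTensor P
          ((HopfAlgebra.antipode k (A := P)).rTensor _ z) := by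
      rw [← hz, ← LinearMap.comp_apply, ← LinearMap.comp_apply, LinearMap.rTensor_comp_lTensor,
        LinearMap.lTensor_comp_rTensor]
    rw [h1]
    apply map_val_mem_universalHorizontal
    rw [← h1, HopfAlgebra.mul_antipode_rTensor_comul_apply, hε, map_zero]
  have key : ∀ t s : P ⊗[k] P, (HopfAlgebra.antipode k (A := P)).rTensor P t ∈
      universalHorizontal (coinvariants (pushCoaction π)) →
      bimulForms a 1 ((HopfAlgebra.antipode k (A := P)).rTensor P (t * s)) ∈
        universalHorizontal (coinvariants (pushCoaction π)) := by
    intro t s ht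
    induction s with
    | zero => simp
    | add x y hx hy => simp only [mul_add, map_add]; exact add_mem hx hy
    | tmul x y =>
      have : bimulForms a 1 ((HopfAlgebra.antipode k (A := P)).rTensor P (t * x ⊗ₜ y)) =
          bimulForms (a * HopfAlgebra.antipode k x) y
            ((HopfAlgebra.antipode k (A := P)).rTensor P t) := by
        clear ht
        induction t with
        | zero => simp
        | add x y hx hy => simp only [add_mul, map_add, hx, hy]
        | tmul x' y' =>
          simp [bimulForms_tmul, HopfAlgebra.antipode_mul_antidistrib, mul_assoc]
      rw [this]
      exact bimulForms_mem_universalHorizontal _ _ ht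
  rw [kappa_tmul, Bialgebra.comul_mul]
  exact key _ _ hdb

/-- The kernel is `κ(P ⊗ ker π)` by `tildeMap_kappa` and flatness; exactness of `π` splits `ker π`
into products `b p` with `b` coinvariant in `ker π`. -/
theorem ker_tildeMap_le_universalHorizontal {π : P →ₐc[k] A} (hπ : IsExactProjection π) :
    LinearMap.ker (tildeMap (pushCoaction π)) ≤
      universalHorizontal (coinvariants (pushCoaction π)) := by
  intro x hx
  obtain ⟨y, rfl⟩ : ∃ y, kappa k P y = x := ⟨_, kappa_tildeMap_comul x⟩
  rw [LinearMap.mem_ker, tildeMap_kappa] at hx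
  obtain ⟨z, rfl⟩ := (Module.Flat.lTensor_exact P
    (LinearMap.exact_subtype_ker_map (π : P →ₗ[k] A)) y).1 hx
  suffices h : tensorLeft P (LinearMap.ker (π : P →ₗ[k] A)) ≤
      (universalHorizontal (coinvariants (pushCoaction π))).comap (kappa k P) from h ⟨z, rfl⟩
  refine tensorLeft_le fun a m hm => ?_
  change kappa k P (a ⊗ₜ m) ∈ universalHorizontal (coinvariants (pushCoaction π))
  refine Submodule.mul_induction_on (hπ hm)
    (fun b hb p _ => kappa_mul_mem_universalHorizontal π a p hb.1 hb.2) fun x y hx hy => ?_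
  rw [TensorProduct.tmul_add, map_add]
  exact add_mem hx hy

end Hopf
end HomogeneousBundles
end QuantumBundle

namespace QuantumBundle

/-! ### Covariance of the calculus and the criterion for homogeneous bundles -/

section Criterion

variable {k : Type*} [Field k] {P : Type*} {A : Type*} [Ring P] [Ring A]
variable [HopfAlgebra k P] [HopfAlgebra k A]

/-- Factors the pushed adjoint coaction as `(1 ⊗ π S(m₍₁₎)) · ρ(m₍₂₎)`. In this form it combines
with the multiplicativity of `ρ` and can be compared with `torusAd`. -/
theorem map_Ad_eq (π : P →ₐc[k] A) (m : P) : (π : P →ₗ[k] A).lTensor P (Ad k P m) =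
    LinearMap.mul' k (P ⊗[k] A) (TensorProduct.map
      ((TensorProduct.mk k P A 1) ∘ₗ (π : P →ₗ[k] A) ∘ₗ HopfAlgebra.antipode k (A := P))
      (pushCoaction π).toLinearMap (Coalgebra.comul (R := k) m)) := by
  change (π : P →ₗ[k] A).lTensor P
    ((LinearMap.mul' k P ∘ₗ (HopfAlgebra.antipode k (A := P)).rTensor P).lTensor P
      (TensorProduct.leftComm k P P P ((Coalgebra.comul (R := k) (A := P)).lTensor P
        (Coalgebra.comul (R := k) m)))) = _
  generalize Coalgebra.comul (R := k) m = t
  induction t with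
  | zero => simp
  | add a b ha hb => simp only [map_add, ha, hb]
  | tmul x y =>
    simp only [LinearMap.lTensor_tmul, TensorProduct.map_tmul, AlgHom.toLinearMap_apply,
      pushCoaction_apply]
    generalize Coalgebra.comul (R := k) y = s
    induction s with
    | zero => simp
    | add a b ha hb => simp only [map_add, TensorProduct.tmul_add, ha, hb]
    | tmul a b => simp

/-- `v₍₁₎ ⊗ π(v₍₂₎ S(v₍₃₎)) = v ⊗ 1`; this is the cancellation used in `tildeMap_coactionForms`. -/
theorem pushCoaction_mul_antipode (π : P →ₐc[k] A) (v : P) :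
    LinearMap.mul' k (P ⊗[k] A) (TensorProduct.map (pushCoaction π).toLinearMap
      ((TensorProduct.mk k P A 1) ∘ₗ (π : P →ₗ[k] A) ∘ₗ HopfAlgebra.antipode k (A := P))
      (Coalgebra.comul (R := k) v)) = v ⊗ₜ[k] 1 := by
  have h1 : ∀ t : P ⊗[k] P, LinearMap.mul' k (P ⊗[k] A) (TensorProduct.map
      (pushCoaction π).toLinearMap
      ((TensorProduct.mk k P A 1) ∘ₗ (π : P →ₗ[k] A) ∘ₗ HopfAlgebra.antipode k (A := P)) t) =
      ((π : P →ₗ[k] A) ∘ₗ LinearMap.mul' k P ∘ₗ (HopfAlgebra.antipode k).lTensor P).lTensor P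
        (TensorProduct.assoc k P P P ((Coalgebra.comul (R := k)).rTensor P t)) := by
    intro t
    induction t with
    | zero => simp
    | add a b ha hb => simp only [map_add, ha, hb]
    | tmul x y =>
      simp only [LinearMap.rTensor_tmul, TensorProduct.map_tmul, AlgHom.toLinearMap_apply,
        pushCoaction_apply]
      generalize Coalgebra.comul (R := k) x = s
      induction s with
      | zero => simp
      | add a b ha hb => simp only [map_add, TensorProduct.add_tmul, ha, hb]
      | tmul a b => simp
  rw [h1, Coalgebra.coassoc_apply]
  have h2 : ∀ t : P ⊗[k] P,
      ((π : P →ₗ[k] A) ∘ₗ LinearMap.mul' k P ∘ₗ (HopfAlgebra.antipode k).lTensor P).lTensor P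
        ((Coalgebra.comul (R := k)).lTensor P t) =
      (Algebra.linearMap k A).lTensor P ((Coalgebra.counit (R := k)).lTensor P t) := by
    intro t
    induction t with
    | zero => simp
    | add a b ha hb => simp only [map_add, ha, hb]
    | tmul x y =>
      simp only [LinearMap.lTensor_tmul, LinearMap.comp_apply,
        HopfAlgebra.mul_antipode_lTensor_comul_apply]
      congr 1
      exact AlgHomClass.commutes π _
  rw [h2, Coalgebra.lTensor_counit_comul]
  simp

/-- In terms of `P ⊗ P ≅ P ⊗ P`, `u ⊗ v ↦ u v₍₁₎ ⊗ v₍₂₎`, the coaction on forms is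
`a ⊗ m ↦ a⁽¹⁾ ⊗ m₍₂₎ ⊗ a⁽²⁾ π(S(m₍₁₎) m₍₃₎)`. -/
theorem tildeMap_coactionForms (π : P →ₐc[k] A) (x : P ⊗[k] P) :
    (tildeMap (Bialgebra.comulAlgHom k P)).rTensor A (coactionForms (pushCoaction π) x) =
      LinearMap.mul' k ((P ⊗[k] P) ⊗[k] A) (TensorProduct.map
        ((Algebra.TensorProduct.map
          (Algebra.TensorProduct.includeLeft : P →ₐ[k] P ⊗[k] P) (.id k A)).comp
            (pushCoaction π)).toLinearMap
        ((Algebra.TensorProduct.map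
          (Algebra.TensorProduct.includeRight : P →ₐ[k] P ⊗[k] P) (.id k A)).toLinearMap ∘ₗ
            (π : P →ₗ[k] A).lTensor P ∘ₗ Ad k P)
        (tildeMap (Bialgebra.comulAlgHom k P) x)) := by
  set ρ := pushCoaction π with hρ
  set j : P ⊗[k] A →ₐ[k] (P ⊗[k] P) ⊗[k] A := Algebra.TensorProduct.map
    (Algebra.TensorProduct.includeLeft : P →ₐ[k] P ⊗[k] P) (.id k A) with hj
  set i : P ⊗[k] A →ₐ[k] (P ⊗[k] P) ⊗[k] A := Algebra.TensorProduct.map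
    (Algebra.TensorProduct.includeRight : P →ₐ[k] P ⊗[k] P) (.id k A) with hi
  set f : P →ₗ[k] P ⊗[k] A :=
    (TensorProduct.mk k P A 1) ∘ₗ (π : P →ₗ[k] A) ∘ₗ HopfAlgebra.antipode k (A := P) with hf
  -- The element `f y` lives in the `A`-leg only, so it can move from the factor embedded by `i` to
  -- the one embedded by `j`.
  have hji : ∀ y : P, j (f y) = i (f y) := fun y => by simp [hj, hi, hf]
  -- The case `u = 1`: the left side is `j(ρ(v₍₁₎) f(v₍₂₎)) · i(ρ(v₍₃₎))`, whose first factor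
  -- collapses by `pushCoaction_mul_antipode`, leaving `v₍₁₎ ⊗ v₍₂₎ ⊗ π(v₍₃₎)`.
  have main : ∀ v : P, LinearMap.mul' k ((P ⊗[k] P) ⊗[k] A) (TensorProduct.map
      (j.comp ρ).toLinearMap (i.toLinearMap ∘ₗ (π : P →ₗ[k] A).lTensor P ∘ₗ Ad k P)
        (Coalgebra.comul (R := k) v)) = (Coalgebra.comul (R := k)).rTensor A (ρ v) := by
    intro v
    have h1 : ∀ t : P ⊗[k] P, LinearMap.mul' k ((P ⊗[k] P) ⊗[k] A) (TensorProduct.map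
        (j.comp ρ).toLinearMap (i.toLinearMap ∘ₗ (π : P →ₗ[k] A).lTensor P ∘ₗ Ad k P) t) =
        LinearMap.mul' k ((P ⊗[k] P) ⊗[k] A) (TensorProduct.map
          (j.toLinearMap ∘ₗ LinearMap.mul' k (P ⊗[k] A) ∘ₗ TensorProduct.map ρ.toLinearMap f)
          (i.comp ρ).toLinearMap ((TensorProduct.assoc k P P P).symm
            ((Coalgebra.comul (R := k)).lTensor P t))) := by
      intro t
      induction t with
      | zero => simp
      | add a b ha hb => simp only [map_add, ha, hb]
      | tmul x y =>
        simp only [LinearMap.lTensor_tmul, TensorProduct.map_tmul, LinearMap.comp_apply,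
          AlgHom.toLinearMap_apply, map_Ad_eq, LinearMap.mul'_apply, AlgHom.comp_apply]
        generalize Coalgebra.comul (R := k) y = s
        induction s with
        | zero => simp
        | add a b ha hb => simp only [map_add, TensorProduct.tmul_add, mul_add, ha, hb]
        | tmul a b =>
          simp only [TensorProduct.map_tmul, TensorProduct.assoc_symm_tmul, LinearMap.comp_apply,
            LinearMap.mul'_apply, AlgHom.toLinearMap_apply, AlgHom.comp_apply, map_mul]
          rw [hji, mul_assoc]
          rfl
    have h2 : ∀ t : P ⊗[k] P, LinearMap.mul' k ((P ⊗[k] P) ⊗[k] A) (TensorProduct.map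
        (j.toLinearMap ∘ₗ LinearMap.mul' k (P ⊗[k] A) ∘ₗ TensorProduct.map ρ.toLinearMap f)
        (i.comp ρ).toLinearMap ((Coalgebra.comul (R := k)).rTensor P t)) =
        (TensorProduct.assoc k P P A).symm (((π : P →ₗ[k] A).lTensor P).lTensor P
          ((Coalgebra.comul (R := k)).lTensor P t)) := by
      intro t
      induction t with
      | zero => simp
      | add a b ha hb => simp only [map_add, ha, hb]
      | tmul x y =>
        simp only [LinearMap.rTensor_tmul, LinearMap.lTensor_tmul, TensorProduct.map_tmul,
          LinearMap.comp_apply, LinearMap.mul'_apply, AlgHom.toLinearMap_apply,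
          AlgHom.comp_apply]
        rw [hf, hρ, pushCoaction_mul_antipode, pushCoaction_apply]
        generalize Coalgebra.comul (R := k) y = s
        induction s with
        | zero => simp
        | add a b ha hb => simp only [map_add, TensorProduct.tmul_add, mul_add, ha, hb]
        | tmul a b => simp [hj, hi]
    have h3 : ∀ t : P ⊗[k] P, (TensorProduct.assoc k P P A).symm
        (((π : P →ₗ[k] A).lTensor P).lTensor P
          (TensorProduct.assoc k P P P ((Coalgebra.comul (R := k)).rTensor P t))) =
        (Coalgebra.comul (R := k)).rTensor A ((π : P →ₗ[k] A).lTensor P t) := by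
      intro t
      induction t with
      | zero => simp
      | add a b ha hb => simp only [map_add, ha, hb]
      | tmul x y =>
        simp only [LinearMap.rTensor_tmul, LinearMap.lTensor_tmul]
        generalize Coalgebra.comul (R := k) x = s
        induction s with
        | zero => simp
        | add a b ha hb => simp only [map_add, TensorProduct.add_tmul, ha, hb]
        | tmul a b => simp
    rw [h1, Coalgebra.coassoc_symm_apply, h2, ← Coalgebra.coassoc_apply, h3, hρ,
      pushCoaction_apply]
  induction x with
  | zero => simp
  | add a b ha hb => simp only [map_add, ha, hb]
  | tmul u v =>
    have h1 : ∀ t : P ⊗[k] P, LinearMap.mul' k ((P ⊗[k] P) ⊗[k] A) (TensorProduct.map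
        (j.comp ρ).toLinearMap (i.toLinearMap ∘ₗ (π : P →ₗ[k] A).lTensor P ∘ₗ Ad k P)
        ((u ⊗ₜ[k] 1) * t)) = j (ρ u) * LinearMap.mul' k ((P ⊗[k] P) ⊗[k] A) (TensorProduct.map
        (j.comp ρ).toLinearMap (i.toLinearMap ∘ₗ (π : P →ₗ[k] A).lTensor P ∘ₗ Ad k P) t) := by
      intro t
      induction t with
      | zero => simp
      | add a b ha hb => simp only [map_add, mul_add, ha, hb]
      | tmul x y =>
        simp only [Algebra.TensorProduct.tmul_mul_tmul, TensorProduct.map_tmul, one_mul,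
          LinearMap.mul'_apply, AlgHom.toLinearMap_apply, AlgHom.comp_apply, map_mul, mul_assoc]
    have h2 : ∀ s t : P ⊗[k] A, (tildeMap (Bialgebra.comulAlgHom k P)).rTensor A
        ((LinearMap.mul' k A).lTensor (P ⊗[k] P)
          (TensorProduct.tensorTensorTensorComm k P A P A (s ⊗ₜ t))) =
        j s * (Coalgebra.comul (R := k)).rTensor A t := by
      intro s t
      induction s with
      | zero => simp
      | add a b ha hb => simp only [TensorProduct.add_tmul, map_add, add_mul, ha, hb]
      | tmul a b =>
        induction t with
        | zero => simp
        | add a b ha hb => simp only [TensorProduct.tmul_add, map_add, mul_add, ha, hb]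
        | tmul c d => simp [tildeMap_tmul, hj]
    rw [tildeMap_tmul, Bialgebra.comulAlgHom_apply, h1, main, ← h2]
    rfl

/-- Transported to `P ⊗ M`, the coaction on forms acts on the second leg by `(id ⊗ π) Ad`, hence
stays in `P ⊗ M ⊗ A`; applying `kappa` returns to `formsOfIdeal M`. -/
theorem map_coactionForms_le {π : P →ₐc[k] A} {M : Submodule k P}
    (hM : M.map ((π : P →ₗ[k] A).lTensor P ∘ₗ Ad k P) ≤ tensorRight M A) :
    (formsOfIdeal M).map (coactionForms (pushCoaction π)) ≤ tensorRight (formsOfIdeal M) A := by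
  rintro _ ⟨x, hx, rfl⟩
  have hx' := mem_formsOfIdeal_iff.1 hx
  have h1 : (tildeMap (Bialgebra.comulAlgHom k P)).rTensor A
      (coactionForms (pushCoaction π) x) ∈ tensorRight (tensorLeft P M) A := by
    rw [tildeMap_coactionForms]
    revert hx'
    generalize tildeMap (Bialgebra.comulAlgHom k P) x = y
    intro hy
    have key : ∀ s : P ⊗[k] A, ∀ t ∈ tensorRight M A, Algebra.TensorProduct.map
        (Algebra.TensorProduct.includeLeft : P →ₐ[k] P ⊗[k] P) (.id k A) s *
        Algebra.TensorProduct.map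
          (Algebra.TensorProduct.includeRight : P →ₐ[k] P ⊗[k] P) (.id k A) t ∈
        tensorRight (tensorLeft P M) A := by
      intro s t ht
      obtain ⟨t, rfl⟩ := ht
      induction s with
      | zero => simp
      | add a b ha hb => rw [map_add, add_mul]; exact add_mem ha hb
      | tmul a b =>
        induction t with
        | zero => simp
        | add a b ha hb => rw [map_add, map_add, mul_add]; exact add_mem ha hb
        | tmul c d =>
          simpa using tmul_mem_tensorRight (tmul_mem_tensorLeft a c.2) (b * d)
    revert y
    change tensorLeft P M ≤ (tensorRight (tensorLeft P M) A).comap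
      (LinearMap.mul' k ((P ⊗[k] P) ⊗[k] A) ∘ₗ TensorProduct.map _ _)
    exact tensorLeft_le fun a m hm => key _ _ (hM (Submodule.mem_map_of_mem hm))
  have h2 : tensorRight (tensorLeft P M) A ≤
      (tensorRight (formsOfIdeal M) A).comap ((kappa k P).rTensor A) :=
    tensorRight_le fun v hv w =>
      tmul_mem_tensorRight (N := formsOfIdeal M) (Submodule.mem_map_of_mem hv) w
  have h3 := h2 h1
  rw [Submodule.mem_comap, ← LinearMap.comp_apply, ← LinearMap.rTensor_comp] at h3
  have h4 : kappa k P ∘ₗ tildeMap (Bialgebra.comulAlgHom k P) = LinearMap.id :=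
    LinearMap.ext kappa_tildeMap_comul
  rwa [h4, LinearMap.rTensor_id] at h3

/-- The criterion for homogeneous bundles: the data of a homogeneous bundle define a quantum
principal bundle over the quantum homogeneous space. -/
theorem IsHomogeneousBundleData.isQuantumPrincipalBundle {π : P →ₐc[k] A}
    {MP : Submodule k P} {MA : Submodule k A} (h : IsHomogeneousBundleData π MP MA) :
    IsQuantumPrincipalBundle (pushCoaction π) (coinvariants (pushCoaction π))
      (formsOfIdeal MP) MA := by
  have hN := isSubbimoduleOfForms_formsOfIdeal h.calculus_total
  have hle : (formsOfIdeal MP).map (tildeMap (pushCoaction π)) ≤ tensorLeft P MA := by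
    rw [formsOfIdeal, Submodule.map_le_iff_le_comap, Submodule.map_le_iff_le_comap]
    refine tensorLeft_le fun a m hm => ?_
    rw [Submodule.mem_comap, Submodule.mem_comap, tildeMap_kappa, LinearMap.lTensor_tmul]
    exact tmul_mem_tensorLeft _ (h.eq_map ▸ ⟨m, hm, rfl⟩)
  -- This inclusion needs every element of `M_A` to come from `M_P`; it supplies the correction by
  -- an element of `N_P` below.
  have hge : tensorLeft P MA ≤ (formsOfIdeal MP).map (tildeMap (pushCoaction π)) := by
    refine tensorLeft_le fun a m hm => ?_
    rw [h.eq_map] at hm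
    obtain ⟨m, hm, rfl⟩ := hm
    exact ⟨kappa k P (a ⊗ₜ m), ⟨_, tmul_mem_tensorLeft a hm, rfl⟩, by
      rw [tildeMap_kappa, LinearMap.lTensor_tmul]⟩
  refine ⟨hN, h.calculus_fiber, isRightComoduleAlgebra_pushCoaction π, rfl, fun y => ?_,
    map_coactionForms_le h.map_Ad_le, hle, ?_⟩
  · obtain ⟨x, rfl⟩ := LinearMap.lTensor_surjective P (g := (π : P →ₗ[k] A)) h.surjective y
    exact ⟨_, tildeMap_kappa π x⟩
  · ext x
    obtain ⟨x, rfl⟩ := Submodule.mkQ_surjective _ x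
    have hx : x ∈ (LinearMap.ker (tildeForms (pushCoaction π) (formsOfIdeal MP) MA hle)).comap
        (Submodule.mkQ _) ↔ tildeMap (pushCoaction π) x ∈ tensorLeft P MA :=
      mem_tensorLeft_iff.symm
    change x ∈ (LinearMap.ker (tildeForms (pushCoaction π) (formsOfIdeal MP) MA hle)).comap
        (Submodule.mkQ _) ↔ _
    rw [hx]
    constructor
    · intro hx
      obtain ⟨n, hn, hnx⟩ := hge hx
      -- Subtracting `n ∈ N_P` does not change the class of `x` and brings it into the kernel of
      -- `tildeMap`, where the universal statement applies.
      have hd : (x : P ⊗[k] P) - n ∈ universalHorizontal (coinvariants (pushCoaction π)) := by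
        apply ker_tildeMap_le_universalHorizontal h.exact
        rw [LinearMap.mem_ker, map_sub, hnx, sub_self]
      refine ⟨⟨x - n, sub_mem x.2 (hN.le hn)⟩, hd, ?_⟩
      rw [Submodule.mkQ_apply, Submodule.mkQ_apply, Submodule.Quotient.eq]
      change (x : P ⊗[k] P) - n - x ∈ formsOfIdeal MP
      simpa using neg_mem hn
    · rintro ⟨y, hy, hyx⟩
      rw [Submodule.mkQ_apply, Submodule.mkQ_apply, Submodule.Quotient.eq] at hyx
      have hyx' : (y : P ⊗[k] P) - x ∈ formsOfIdeal MP := hyx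
      have h0 : tildeMap (pushCoaction π) (y : P ⊗[k] P) = 0 :=
        universalHorizontal_le_ker_tildeMap le_rfl hy
      have := hle ⟨_, hyx', rfl⟩
      rw [map_sub, h0, zero_sub] at this
      exact neg_mem_iff.1 this

end Criterion
end QuantumBundle

namespace QuantumBundle

/-! ### Laurent polynomials as a Hopf algebra -/

section Laurent

variable {k : Type*} [Field k]

theorem laurent_linearMap_ext {V : Type*} [AddCommGroup V] [Module k V] {f g : k[T;T⁻¹] →ₗ[k] V}
    (h : ∀ n, f (T n) = g (T n)) : f = g :=
  (AddMonoidAlgebra.basis ℤ k).ext fun n => by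
    rw [AddMonoidAlgebra.basis_apply]
    exact h n

theorem laurent_mem_of_T_mem {W : Submodule k k[T;T⁻¹]} (h : ∀ n, T n ∈ W) (f : k[T;T⁻¹]) :
    f ∈ W := by
  induction f using LaurentPolynomial.induction_on' with
  | add p r hp hr => exact add_mem hp hr
  | C_mul_T n a => rw [← smul_eq_C_mul]; exact W.smul_mem a (h n)

/-- The coefficient of `T n`. -/
noncomputable def laurentCoeff (n : ℤ) : k[T;T⁻¹] →ₗ[k] k := (AddMonoidAlgebra.basis ℤ k).coord n

theorem laurentCoeff_T (n m : ℤ) : laurentCoeff (k := k) n (T m) = if m = n then 1 else 0 :=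
  T_apply n m

theorem laurentCoeff_mul_T (n m : ℤ) (f : k[T;T⁻¹]) :
    laurentCoeff n (f * T m) = laurentCoeff (n - m) f := by
  have h : laurentCoeff n ∘ₗ LinearMap.mulRight k (T m) = laurentCoeff (k := k) (n - m) := by
    refine laurent_linearMap_ext fun j => ?_
    rw [LinearMap.comp_apply, LinearMap.mulRight_apply, ← T_add, laurentCoeff_T, laurentCoeff_T]
    simp only [eq_sub_iff_add_eq]
  exact LinearMap.congr_fun h f

/-- Each `T n` is group-like and `T (-n) * T n = 1`, so the adjoint coaction is trivial and every
subspace is `Ad`-invariant. -/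
theorem Ad_laurent (f : k[T;T⁻¹]) : Ad k k[T;T⁻¹] f = f ⊗ₜ 1 := by
  have h : Ad k k[T;T⁻¹] = (TensorProduct.mk k k[T;T⁻¹] k[T;T⁻¹]).flip 1 := by
    refine laurent_linearMap_ext fun n => ?_
    have h1 : Coalgebra.comul (R := k) (T n : k[T;T⁻¹]) = T n ⊗ₜ T n := by simp
    have h2 : HopfAlgebra.antipode k (T n : k[T;T⁻¹]) = T (-n) := by simp
    simp only [Ad, LinearMap.comp_apply, h1, LinearMap.lTensor_tmul, LinearEquiv.coe_coe,
      TensorProduct.leftComm_tmul, LinearMap.rTensor_tmul, h2, LinearMap.mul'_apply, ← T_add]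
    simp
  rw [h]
  rfl

end Laurent

/-! ### The torus coaction on `SU_q(2)` and the quantum sphere -/

namespace SUq2

universe u
variable {k : Type u} [Field k]

theorem gen_α (q : kˣ) : gen q .α = α q := rfl
theorem gen_β (q : kˣ) : gen q .β = β q := rfl
theorem gen_γ (q : kˣ) : gen q .γ = γ q := rfl
theorem gen_δ (q : kˣ) : gen q .δ = δ q := rfl

/-- Together with its mirror image, this induction principle replaces a basis of monomials for
statements about all of `SU_q(2)`. -/
theorem mem_of_gen_mul_mem {q : kˣ} {W : Submodule k (SUq2 q)} (h1 : 1 ∈ W)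
    (h : ∀ g, ∀ w ∈ W, gen q g * w ∈ W) (x : SUq2 q) : x ∈ W := by
  have hx : x ∈ Algebra.adjoin k (Set.range (gen q)) := adjoin_gen q ▸ Algebra.mem_top
  -- Stability of all of `W` under `x`, unlike `x ∈ W`, is inherited by products.
  suffices ∀ w ∈ W, x * w ∈ W by simpa using this 1 h1
  induction hx using Algebra.adjoin_induction with
  | mem x hx => obtain ⟨g, rfl⟩ := hx; exact h g
  | algebraMap r => intro w hw; rw [← Algebra.smul_def]; exact W.smul_mem r hw
  | add a b _ _ ha hb => intro w hw; rw [add_mul]; exact add_mem (ha w hw) (hb w hw)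
  | mul a b _ _ ha hb => intro w hw; rw [mul_assoc]; exact ha _ (hb w hw)

theorem mem_of_mul_gen_mem {q : kˣ} {W : Submodule k (SUq2 q)} (h1 : 1 ∈ W)
    (h : ∀ g, ∀ w ∈ W, w * gen q g ∈ W) (x : SUq2 q) : x ∈ W := by
  have hx : x ∈ Algebra.adjoin k (Set.range (gen q)) := adjoin_gen q ▸ Algebra.mem_top
  suffices ∀ w ∈ W, w * x ∈ W by simpa using this 1 h1
  induction hx using Algebra.adjoin_induction with
  | mem x hx => obtain ⟨g, rfl⟩ := hx; exact h g
  | algebraMap r =>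
    intro w hw
    rw [← Algebra.commutes, ← Algebra.smul_def]
    exact W.smul_mem r hw
  | add a b _ _ ha hb => intro w hw; rw [mul_add]; exact add_mem (ha w hw) (hb w hw)
  | mul a b _ _ ha hb => intro w hw; rw [← mul_assoc]; exact hb _ (ha w hw)

/-- The weight of a generator under the right coaction of the torus. -/
def weight : Gen → ℤ
  | .α => 1
  | .β => -1
  | .γ => 1
  | .δ => -1

/-- The projection to the torus as a bialgebra map. -/
noncomputable def toTorusBialg (q : kˣ) : SUq2 q →ₐc[k] k[T;T⁻¹] :=
  BialgHom.ofAlgHom (toTorus q) (AlgHom.ext (counit_toTorus q))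
    (AlgHom.ext fun x => (comul_toTorus q x).symm)

theorem torusCoaction_gen (q : kˣ) (g : Gen) :
    pushCoaction (toTorusBialg q) (gen q g) = gen q g ⊗ₜ T (weight g) := by
  rw [pushCoaction_apply]
  have h : (toTorusBialg q : SUq2 q →ₗ[k] k[T;T⁻¹]) = (toTorus q).toLinearMap := rfl
  rw [h]
  rcases g with _ | _ | _ | _ <;>
  simp [gen_α, gen_β, gen_γ, gen_δ, comul_α, comul_β, comul_γ, comul_δ, toTorus_α, toTorus_β,
    toTorus_γ, toTorus_δ, weight]

theorem torusCoaction_α (q : kˣ) : pushCoaction (toTorusBialg q) (α q) = α q ⊗ₜ T 1 :=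
  torusCoaction_gen q .α
theorem torusCoaction_β (q : kˣ) : pushCoaction (toTorusBialg q) (β q) = β q ⊗ₜ T (-1) :=
  torusCoaction_gen q .β
theorem torusCoaction_γ (q : kˣ) : pushCoaction (toTorusBialg q) (γ q) = γ q ⊗ₜ T 1 :=
  torusCoaction_gen q .γ
theorem torusCoaction_δ (q : kˣ) : pushCoaction (toTorusBialg q) (δ q) = δ q ⊗ₜ T (-1) :=
  torusCoaction_gen q .δ

section Sphere

/-- The quantum sphere as a subalgebra of `SU_q(2)`. -/
def sphere (q : kˣ) : Subalgebra k (SUq2 q) :=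
  Algebra.adjoin k {α q * β q, γ q * δ q, α q * δ q}

/-- The span of the generators of weight one. -/
def spanPos (q : kˣ) : Submodule k (SUq2 q) := Submodule.span k {α q, γ q}

/-- The span of the generators of weight minus one. -/
def spanNeg (q : kˣ) : Submodule k (SUq2 q) := Submodule.span k {β q, δ q}

theorem α_mul_β_mem_sphere (q : kˣ) : α q * β q ∈ sphere q :=
  Algebra.subset_adjoin (by simp)
theorem γ_mul_δ_mem_sphere (q : kˣ) : γ q * δ q ∈ sphere q :=
  Algebra.subset_adjoin (by simp)
theorem α_mul_δ_mem_sphere (q : kˣ) : α q * δ q ∈ sphere q :=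
  Algebra.subset_adjoin (by simp)

/-- The determinant relation expresses `β γ` through the generator `α δ`; this uses that `q` is
invertible. -/
theorem β_mul_γ_mem_sphere (q : kˣ) : β q * γ q ∈ sphere q := by
  have h : β q * γ q = (q : k)⁻¹ • (α q * δ q - 1) := by
    rw [α_mul_δ, add_sub_cancel_left, smul_smul]
    simp
  rw [h]
  exact Subalgebra.smul_mem _ (sub_mem (α_mul_δ_mem_sphere q) (one_mem _)) _

theorem spanPos_mul_spanNeg_le_sphere (q : kˣ) :
    spanPos q * spanNeg q ≤ Subalgebra.toSubmodule (sphere q) := by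
  rw [spanPos, spanNeg, Submodule.span_mul_span, Submodule.span_le]
  rintro _ ⟨x, rfl | rfl, y, rfl | rfl, rfl⟩
  · exact α_mul_β_mem_sphere q
  · exact α_mul_δ_mem_sphere q
  · change γ q * β q ∈ sphere q
    rw [γ_mul_β]
    exact β_mul_γ_mem_sphere q
  · exact γ_mul_δ_mem_sphere q

/-- The quadratic relations exchange the two spans as subspaces, although not element by element: `α
δ` acquires a `β γ` term. This lets factors of opposite weight be moved past one another. -/
theorem spanPos_mul_spanNeg (q : kˣ) : spanPos q * spanNeg q = spanNeg q * spanPos q := by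
  have hα : α q ∈ spanPos q := Submodule.subset_span (by simp)
  have hγ : γ q ∈ spanPos q := Submodule.subset_span (by simp)
  have hβ : β q ∈ spanNeg q := Submodule.subset_span (by simp)
  have hδ : δ q ∈ spanNeg q := Submodule.subset_span (by simp)
  have hq : (q : k) ≠ 0 := q.ne_zero
  have h := isQuantumMatrix q
  apply le_antisymm
  · conv_lhs => rw [spanPos, spanNeg, Submodule.span_mul_span]
    rw [Submodule.span_le]
    rintro _ ⟨x, rfl | rfl, y, rfl | rfl, rfl⟩
    · change α q * β q ∈ _
      rw [h.ab]
      exact Submodule.smul_mem _ _ (Submodule.mul_mem_mul hβ hα)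
    · change α q * δ q ∈ _
      rw [h.ad]
      exact add_mem (Submodule.mul_mem_mul hδ hα)
        (Submodule.smul_mem _ _ (Submodule.mul_mem_mul hβ hγ))
    · change γ q * β q ∈ _
      rw [γ_mul_β]
      exact Submodule.mul_mem_mul hβ hγ
    · change γ q * δ q ∈ _
      rw [h.cd]
      exact Submodule.smul_mem _ _ (Submodule.mul_mem_mul hδ hγ)
  · conv_lhs => rw [spanPos, spanNeg, Submodule.span_mul_span]
    rw [Submodule.span_le]
    rintro _ ⟨x, rfl | rfl, y, rfl | rfl, rfl⟩
    · change β q * α q ∈ _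
      have : β q * α q = (q : k)⁻¹ • (α q * β q) := by rw [h.ab, smul_smul]; simp
      rw [this]
      exact Submodule.smul_mem _ _ (Submodule.mul_mem_mul hα hβ)
    · change β q * γ q ∈ _
      rw [h.bc]
      exact Submodule.mul_mem_mul hγ hβ
    · change δ q * α q ∈ _
      have : δ q * α q = α q * δ q - ((q : k) - (q : k)⁻¹) • (γ q * β q) := by
        rw [h.ad, γ_mul_β, add_sub_cancel_right]
      rw [this]
      exact sub_mem (Submodule.mul_mem_mul hα hδ)
        (Submodule.smul_mem _ _ (Submodule.mul_mem_mul hγ hβ))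
    · change δ q * γ q ∈ _
      rw [δ_mul_γ]
      exact Submodule.smul_mem _ _ (Submodule.mul_mem_mul hγ hδ)

end Sphere
end SUq2

/-! ### Subspaces that can be moved across a subalgebra -/

section

variable {k : Type*} [Field k] {R : Type*} [Ring R] [Algebra k R]

/-- If `V` passes each generator, it passes a product one factor at a time, the resulting left
factors being absorbed by the subalgebra. -/
theorem mul_adjoin_le {V : Submodule k R} {s : Set R}
    (h : V * Submodule.span k s ≤ Subalgebra.toSubmodule (Algebra.adjoin k s) * V) :
    V * Subalgebra.toSubmodule (Algebra.adjoin k s) ≤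
      Subalgebra.toSubmodule (Algebra.adjoin k s) * V := by
  have hBB := (Algebra.adjoin k s).isIdempotentElem_toSubmodule.eq
  set B := Subalgebra.toSubmodule (Algebra.adjoin k s) with hB
  rw [Submodule.mul_le]
  intro v hv b hb
  replace hb : b ∈ Algebra.adjoin k s := hb
  induction hb using Algebra.adjoin_induction generalizing v with
  | mem x hx => exact h (Submodule.mul_mem_mul hv (Submodule.subset_span hx))
  | algebraMap r =>
    rw [← Algebra.commutes]
    exact Submodule.mul_mem_mul (Subalgebra.algebraMap_mem _ r) hv
  | add a b _ _ ha hb => rw [mul_add]; exact add_mem (ha v hv) (hb v hv)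
  | mul a b _ _ ha hb =>
    rw [← mul_assoc]
    refine Submodule.mul_induction_on (ha v hv) (fun c hc w hw => ?_) fun x y hx hy => ?_
    · rw [mul_assoc, ← hBB, mul_assoc]
      exact Submodule.mul_mem_mul hc (hb w hw)
    · rw [add_mul]
      exact add_mem hx hy

theorem pow_mul_le_mul_pow {V B : Submodule k R} (h : V * B ≤ B * V) (n : ℕ) :
    V ^ n * B ≤ B * V ^ n := by
  induction n with
  | zero => simp
  | succ n ih =>
    calc V ^ (n + 1) * B = V ^ n * (V * B) := by rw [pow_succ, mul_assoc]
      _ ≤ V ^ n * (B * V) := mul_le_mul' le_rfl h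
      _ = V ^ n * B * V := (mul_assoc _ _ _).symm
      _ ≤ B * V ^ n * V := mul_le_mul' ih le_rfl
      _ = B * V ^ (n + 1) := by rw [pow_succ, mul_assoc]

/-- The last `V` cancels `W` into `B`, which then moves left across `V ^ n`. -/
theorem mul_pow_succ_mul_le {V W B : Submodule k R} (hB : B * B = B) (hVB : V * B ≤ B * V)
    (h : V * W ≤ B) (n : ℕ) : B * V ^ (n + 1) * W ≤ B * V ^ n := by
  calc B * V ^ (n + 1) * W = B * (V ^ n * (V * W)) := by simp only [pow_succ, mul_assoc]
    _ ≤ B * (V ^ n * B) := mul_le_mul' le_rfl (mul_le_mul' le_rfl h)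
    _ ≤ B * (B * V ^ n) := mul_le_mul' le_rfl (pow_mul_le_mul_pow hVB n)
    _ = B * V ^ n := by rw [← mul_assoc, hB]

end

/-! ### Weight components and coinvariants of the torus -/

namespace SUq2

universe u
variable {k : Type u} [Field k]

theorem sphere_mul_self (q : kˣ) : Subalgebra.toSubmodule (sphere q) *
    Subalgebra.toSubmodule (sphere q) = Subalgebra.toSubmodule (sphere q) :=
  (sphere q).isIdempotentElem_toSubmodule.eq

theorem span_sphere_le (q : kˣ) :
    Submodule.span k {α q * β q, γ q * δ q, α q * δ q} ≤ spanPos q * spanNeg q := by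
  have hα : α q ∈ spanPos q := Submodule.subset_span (by simp)
  have hγ : γ q ∈ spanPos q := Submodule.subset_span (by simp)
  have hβ : β q ∈ spanNeg q := Submodule.subset_span (by simp)
  have hδ : δ q ∈ spanNeg q := Submodule.subset_span (by simp)
  rw [Submodule.span_le]
  rintro _ (rfl | rfl | rfl)
  exacts [Submodule.mul_mem_mul hα hβ, Submodule.mul_mem_mul hγ hδ, Submodule.mul_mem_mul hα hδ]

/-- The generators of the sphere lie in `V₊ V₋`, and `V₊ (V₊ V₋) = (V₊ V₋) V₊ ⊆ B V₊`. -/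
theorem spanPos_mul_sphere_le (q : kˣ) : spanPos q * Subalgebra.toSubmodule (sphere q) ≤
    Subalgebra.toSubmodule (sphere q) * spanPos q := by
  refine mul_adjoin_le ((mul_le_mul' le_rfl (span_sphere_le q)).trans ?_)
  rw [spanPos_mul_spanNeg, ← mul_assoc]
  exact mul_le_mul' (spanPos_mul_spanNeg_le_sphere q) le_rfl

theorem spanNeg_mul_sphere_le (q : kˣ) : spanNeg q * Subalgebra.toSubmodule (sphere q) ≤
    Subalgebra.toSubmodule (sphere q) * spanNeg q := by
  refine mul_adjoin_le ((mul_le_mul' le_rfl (span_sphere_le q)).trans ?_)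
  rw [← mul_assoc, ← spanPos_mul_spanNeg]
  exact mul_le_mul' (spanPos_mul_spanNeg_le_sphere q) le_rfl

/-- The component of weight `n` of `SU_q(2)`. -/
def weightSpace (q : kˣ) : ℤ → Submodule k (SUq2 q)
  | .ofNat n => Subalgebra.toSubmodule (sphere q) * spanPos q ^ n
  | .negSucc n => Subalgebra.toSubmodule (sphere q) * spanNeg q ^ (n + 1)

theorem weightSpace_mul_spanPos (q : kˣ) (n : ℤ) :
    weightSpace q n * spanPos q ≤ weightSpace q (n + 1) := by
  obtain n | n := n
  · change _ ≤ Subalgebra.toSubmodule (sphere q) * spanPos q ^ (n + 1)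
    rw [pow_succ, ← mul_assoc]
    exact le_rfl
  · have h := mul_pow_succ_mul_le (sphere_mul_self q) (spanNeg_mul_sphere_le q)
      ((spanPos_mul_spanNeg q).symm.trans_le (spanPos_mul_spanNeg_le_sphere q)) n
    -- From weight `-1` the product lands in weight `0`, where the zeroth powers of `spanNeg` and
    -- `spanPos` agree.
    obtain _ | n := n
    · exact h
    · exact h

theorem weightSpace_mul_spanNeg (q : kˣ) (n : ℤ) :
    weightSpace q n * spanNeg q ≤ weightSpace q (n - 1) := by
  obtain (_ | n) | n := n
  · change Subalgebra.toSubmodule (sphere q) * spanPos q ^ 0 * _ ≤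
      Subalgebra.toSubmodule (sphere q) * spanNeg q ^ 1
    rw [pow_zero, mul_one, pow_one]
  · have h := mul_pow_succ_mul_le (sphere_mul_self q) (spanPos_mul_sphere_le q)
      (spanPos_mul_spanNeg_le_sphere q) n
    have h1 : Int.ofNat (n + 1) - 1 = Int.ofNat n := by simp
    rw [h1]
    exact h
  · have h1 : Int.negSucc n - 1 = Int.negSucc (n + 1) := rfl
    rw [h1]
    change _ ≤ Subalgebra.toSubmodule (sphere q) * spanNeg q ^ (n + 1 + 1)
    rw [pow_succ _ (n + 1), ← mul_assoc]
    exact le_rfl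

theorem mul_gen_mem_weightSpace {q : kˣ} {n : ℤ} (g : Gen) {x : SUq2 q}
    (hx : x ∈ weightSpace q (n - weight g)) : x * gen q g ∈ weightSpace q n := by
  have hpos : ∀ y ∈ spanPos q, x ∈ weightSpace q (n - 1) → x * y ∈ weightSpace q n :=
    fun y hy hx => by simpa using weightSpace_mul_spanPos q _ (Submodule.mul_mem_mul hx hy)
  have hneg : ∀ y ∈ spanNeg q, x ∈ weightSpace q (n - -1) → x * y ∈ weightSpace q n :=
    fun y hy hx => by simpa using weightSpace_mul_spanNeg q _ (Submodule.mul_mem_mul hx hy)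
  rcases g with _ | _ | _ | _
  · exact hpos _ (Submodule.subset_span (by simp [gen_α])) hx
  · exact hneg _ (Submodule.subset_span (by simp [gen_β])) hx
  · exact hpos _ (Submodule.subset_span (by simp [gen_γ])) hx
  · exact hneg _ (Submodule.subset_span (by simp [gen_δ])) hx

/-- The projection to the component of weight `n`. -/
noncomputable def weightProj (q : kˣ) (n : ℤ) : SUq2 q →ₗ[k] SUq2 q :=
  (TensorProduct.rid k (SUq2 q)).toLinearMap ∘ₗ (laurentCoeff n).lTensor (SUq2 q) ∘ₗ
    (pushCoaction (toTorusBialg q)).toLinearMap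

theorem weightProj_apply (q : kˣ) (n : ℤ) (x : SUq2 q) :
    weightProj q n x = TensorProduct.rid k (SUq2 q) ((laurentCoeff n).lTensor (SUq2 q)
      (pushCoaction (toTorusBialg q) x)) := rfl

theorem weightProj_mem (q : kˣ) (n : ℤ) (x : SUq2 q) : weightProj q n x ∈ weightSpace q n := by
  revert n
  -- All weights are treated together, since right multiplication by a generator shifts the weight.
  suffices h : x ∈ ⨅ n, (weightSpace q n).comap (weightProj q n) by
    simpa [Submodule.mem_iInf] using h
  refine mem_of_mul_gen_mem ?_ (fun g w hw => ?_) x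
  · rw [Submodule.mem_iInf]
    intro n
    rw [Submodule.mem_comap, weightProj_apply, map_one, Algebra.TensorProduct.one_def,
      LinearMap.lTensor_tmul, ← T_zero, laurentCoeff_T, TensorProduct.rid_tmul]
    split_ifs with h
    · subst h
      change (1 : k) • (1 : SUq2 q) ∈ Subalgebra.toSubmodule (sphere q) * spanPos q ^ 0
      rw [pow_zero, mul_one, one_smul]
      exact one_mem (sphere q)
    · simp
  · rw [Submodule.mem_iInf] at hw ⊢
    intro n
    have h := hw (n - weight g)
    rw [Submodule.mem_comap] at h ⊢
    have hmul : weightProj q n (w * gen q g) = weightProj q (n - weight g) w * gen q g := by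
      rw [weightProj_apply, weightProj_apply, map_mul, torusCoaction_gen]
      generalize pushCoaction (toTorusBialg q) w = t
      induction t with
      | zero => simp
      | add a b ha hb => simp only [add_mul, map_add, ha, hb]
      | tmul a b =>
        simp [laurentCoeff_mul_T, -mul_T_assoc, -T_mul]
    rw [hmul]
    exact mul_gen_mem_weightSpace g h

/-- The quantum sphere is the algebra of coinvariants of the torus. -/
theorem coinvariants_toTorusBialg (q : kˣ) : coinvariants (pushCoaction (toTorusBialg q)) =
    sphere q := by
  apply le_antisymm
  · intro x hx
    have hx' : pushCoaction (toTorusBialg q) x = x ⊗ₜ 1 := hx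
    -- A coinvariant is its own projection to weight zero, and `weightSpace q 0` is the sphere.
    have h := weightProj_mem q 0 x
    rw [weightProj_apply, hx', LinearMap.lTensor_tmul, ← T_zero, laurentCoeff_T,
      TensorProduct.rid_tmul, if_pos rfl, one_smul] at h
    change x ∈ Subalgebra.toSubmodule (sphere q) * spanPos q ^ 0 at h
    rwa [pow_zero, mul_one] at h
  · refine Algebra.adjoin_le ?_
    rintro _ (rfl | rfl | rfl) <;>
    · change pushCoaction (toTorusBialg q) _ = _ ⊗ₜ 1
      rw [map_mul]
      simp only [torusCoaction_α, torusCoaction_β, torusCoaction_γ, torusCoaction_δ,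
        Algebra.TensorProduct.tmul_mul_tmul, ← T_add]
      simp

end SUq2
end QuantumBundle

namespace QuantumBundle
namespace SUq2

universe u
variable {k : Type u} [Field k]

/-! ### The kernel of the projection to the torus -/

section Kernel

/-- The ideal generated by `β` and `γ`. -/
def offDiagonal (q : kˣ) : Submodule k (SUq2 q) :=
  LinearMap.range (LinearMap.mulLeft k (β q)) ⊔ LinearMap.range (LinearMap.mulLeft k (γ q))

theorem mem_offDiagonal {q : kˣ} {x : SUq2 q} :
    x ∈ offDiagonal q ↔ ∃ u v, x = β q * u + γ q * v := by
  rw [offDiagonal, Submodule.mem_sup]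
  constructor
  · rintro ⟨_, ⟨u, rfl⟩, _, ⟨v, rfl⟩, rfl⟩
    exact ⟨u, v, rfl⟩
  · rintro ⟨u, v, rfl⟩
    exact ⟨_, ⟨u, rfl⟩, _, ⟨v, rfl⟩, rfl⟩

theorem β_mul_mem_offDiagonal (q : kˣ) (u : SUq2 q) : β q * u ∈ offDiagonal q :=
  mem_offDiagonal.2 ⟨u, 0, by simp⟩

theorem γ_mul_mem_offDiagonal (q : kˣ) (u : SUq2 q) : γ q * u ∈ offDiagonal q :=
  mem_offDiagonal.2 ⟨0, u, by simp⟩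

/-- `offDiagonal` is a right ideal by construction; stability on the left holds because `α` commutes
with `β` and `γ` up to the factor `q`. -/
theorem α_mul_mem_offDiagonal {q : kˣ} {x : SUq2 q} (hx : x ∈ offDiagonal q) :
    α q * x ∈ offDiagonal q := by
  obtain ⟨u, v, rfl⟩ := mem_offDiagonal.1 hx
  have h := isQuantumMatrix q
  refine mem_offDiagonal.2 ⟨(q : k) • (α q * u), (q : k) • (α q * v), ?_⟩
  rw [mul_add, ← mul_assoc, ← mul_assoc, h.ab, h.ac]
  simp [mul_assoc]

theorem δ_mul_mem_offDiagonal {q : kˣ} {x : SUq2 q} (hx : x ∈ offDiagonal q) :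
    δ q * x ∈ offDiagonal q := by
  obtain ⟨u, v, rfl⟩ := mem_offDiagonal.1 hx
  refine mem_offDiagonal.2 ⟨(q : k)⁻¹ • (δ q * u), (q : k)⁻¹ • (δ q * v), ?_⟩
  rw [mul_add, ← mul_assoc, ← mul_assoc, δ_mul_β, δ_mul_γ]
  simp [mul_assoc]

/-- The monomials `α ^ n` and `δ ^ n`. -/
def diagonalMonomial (q : kˣ) : ℤ → SUq2 q
  | .ofNat n => α q ^ n
  | .negSucc n => δ q ^ (n + 1)

/-- The linear section of the projection to the torus. -/
noncomputable def torusSection (q : kˣ) : k[T;T⁻¹] →ₗ[k] SUq2 q :=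
  (AddMonoidAlgebra.basis ℤ k).constr k (diagonalMonomial q)

theorem torusSection_T (q : kˣ) (n : ℤ) : torusSection q (T n) = diagonalMonomial q n := by
  have h : (T n : k[T;T⁻¹]) = AddMonoidAlgebra.basis ℤ k n := by
    rw [AddMonoidAlgebra.basis_apply]
    rfl
  rw [h, torusSection, Module.Basis.constr_basis]

/-- The section is multiplicative only modulo `offDiagonal`: `α` prolongs a power of `α`, while
against a power of `δ` it cancels one factor with error from `α δ - 1 = q β γ`. -/
theorem α_mul_torusSection (q : kˣ) (f : k[T;T⁻¹]) :
    α q * torusSection q f - torusSection q (T 1 * f) ∈ offDiagonal q := by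
  suffices h : f ∈ (offDiagonal q).comap (LinearMap.mulLeft k (α q) ∘ₗ torusSection q -
      torusSection q ∘ₗ LinearMap.mulLeft k (T 1)) by
    simpa only [Submodule.mem_comap, LinearMap.sub_apply, LinearMap.comp_apply,
      LinearMap.mulLeft_apply] using h
  refine laurent_mem_of_T_mem (fun n => ?_) f
  simp only [Submodule.mem_comap, LinearMap.sub_apply, LinearMap.comp_apply,
    LinearMap.mulLeft_apply]
  rw [← T_add, torusSection_T, torusSection_T]
  obtain n | _ | n := n
  · have h : 1 + Int.ofNat n = Int.ofNat (n + 1) := by simp [add_comm]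
    rw [h, diagonalMonomial, diagonalMonomial, pow_succ', sub_self]
    exact zero_mem _
  · change α q * δ q ^ 1 - α q ^ 0 ∈ offDiagonal q
    rw [pow_one, pow_zero, α_mul_δ, add_sub_cancel_left]
    exact Submodule.smul_mem _ _ (β_mul_mem_offDiagonal q _)
  · have h : 1 + Int.negSucc (n + 1) = Int.negSucc n := by grind
    rw [h, diagonalMonomial, diagonalMonomial, pow_succ' _ (n + 1), ← mul_assoc, α_mul_δ, add_mul,
      one_mul, add_sub_cancel_left, smul_mul_assoc, mul_assoc]
    exact Submodule.smul_mem _ _ (β_mul_mem_offDiagonal q _)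

theorem δ_mul_torusSection (q : kˣ) (f : k[T;T⁻¹]) :
    δ q * torusSection q f - torusSection q (T (-1) * f) ∈ offDiagonal q := by
  suffices h : f ∈ (offDiagonal q).comap (LinearMap.mulLeft k (δ q) ∘ₗ torusSection q -
      torusSection q ∘ₗ LinearMap.mulLeft k (T (-1))) by
    simpa only [Submodule.mem_comap, LinearMap.sub_apply, LinearMap.comp_apply,
      LinearMap.mulLeft_apply] using h
  refine laurent_mem_of_T_mem (fun n => ?_) f
  simp only [Submodule.mem_comap, LinearMap.sub_apply, LinearMap.comp_apply,
    LinearMap.mulLeft_apply]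
  rw [← T_add, torusSection_T, torusSection_T]
  obtain (_ | n) | n := n
  · change δ q * α q ^ 0 - δ q ^ 1 ∈ offDiagonal q
    simp
  · have h : -1 + Int.ofNat (n + 1) = Int.ofNat n := by simp
    rw [h, diagonalMonomial, diagonalMonomial, pow_succ' _ n, ← mul_assoc, δ_mul_α, add_mul,
      one_mul, add_sub_cancel_left, smul_mul_assoc, mul_assoc]
    exact Submodule.smul_mem _ _ (β_mul_mem_offDiagonal q _)
  · have h : -1 + Int.negSucc n = Int.negSucc (n + 1) := by grind
    rw [h, diagonalMonomial, diagonalMonomial, pow_succ' _ (n + 1), sub_self]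
    exact zero_mem _

/-- Left multiplication by `α` or `δ` respects the section up to `offDiagonal`, and `β`, `γ` land in
it. Hence an element killed by `toTorus` is in `offDiagonal`. -/
theorem sub_torusSection_mem (q : kˣ) (x : SUq2 q) :
    x - torusSection q (toTorus q x) ∈ offDiagonal q := by
  suffices h : x ∈ (offDiagonal q).comap
      (LinearMap.id - torusSection q ∘ₗ (toTorus q).toLinearMap) from h
  refine mem_of_gen_mul_mem ?_ (fun g w hw => ?_) x
  · change 1 - torusSection q (toTorus q 1) ∈ offDiagonal q
    rw [map_one, ← T_zero, torusSection_T]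
    change 1 - α q ^ 0 ∈ offDiagonal q
    simp
  · change w - torusSection q (toTorus q w) ∈ offDiagonal q at hw
    change gen q g * w - torusSection q (toTorus q (gen q g * w)) ∈ offDiagonal q
    rw [map_mul]
    rcases g with _ | _ | _ | _
    · rw [gen_α, toTorus_α]
      have := add_mem (α_mul_mem_offDiagonal hw) (α_mul_torusSection q (toTorus q w))
      rwa [mul_sub, sub_add_sub_cancel] at this
    · rw [gen_β, toTorus_β, zero_mul, map_zero, sub_zero]
      exact β_mul_mem_offDiagonal q w
    · rw [gen_γ, toTorus_γ, zero_mul, map_zero, sub_zero]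
      exact γ_mul_mem_offDiagonal q w
    · rw [gen_δ, toTorus_δ]
      have := add_mem (δ_mul_mem_offDiagonal hw) (δ_mul_torusSection q (toTorus q w))
      rwa [mul_sub, sub_add_sub_cancel] at this

theorem mem_offDiagonal_of_toTorus_eq_zero {q : kˣ} {x : SUq2 q} (hx : toTorus q x = 0) :
    x ∈ offDiagonal q := by
  simpa [hx] using sub_torusSection_mem q x

end Kernel

/-! ### Even and odd elements of `SU_q(2)` -/

section Parity

/-- The relations involve only products of two generators and constants, so a common sign drops out.
-/
theorem parity_rel (q : kˣ) : IsQuantumMatrix q (-α q) (-β q) (-γ q) (-δ q) := by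
  have h := isQuantumMatrix q
  constructor <;> simp only [neg_mul_neg]
  exacts [h.ab, h.ac, h.ad, h.bc, h.bd, h.cd, h.det]

/-- The automorphism of `SU_q(2)` that changes the sign of the generators. -/
noncomputable def parity (q : kˣ) : SUq2 q →ₐ[k] SUq2 q := lift (parity_rel q)

theorem parity_gen (q : kˣ) (g : Gen) : parity q (gen q g) = -gen q g := by
  rw [parity, lift_gen]
  rcases g with _ | _ | _ | _ <;> rfl

theorem parity_eq_self {q : kˣ} {x : SUq2 q} (hx : x ∈ SOq3 q) : parity q x = x := by
  have h : SOq3 q ≤ AlgHom.equalizer (parity q) (.id k _) := by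
    refine Algebra.adjoin_le ?_
    rintro _ ⟨g, h, rfl⟩
    change parity q (gen q g * gen q h) = gen q g * gen q h
    rw [map_mul, parity_gen, parity_gen, neg_mul_neg]
  exact h hx

/-- Up to a factor `2` these are the even and odd parts of `x`. Left multiplication by a generator
exchanges them, so the two claims must be proved together. -/
theorem parity_mem (q : kˣ) (x : SUq2 q) : x + parity q x ∈ SOq3 q ∧
    ∀ g, gen q g * (x - parity q x) ∈ SOq3 q := by
  let S := Subalgebra.toSubmodule (SOq3 q)
  suffices h : x ∈ S.comap (LinearMap.id + (parity q).toLinearMap) ⊓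
      ⨅ g, S.comap (LinearMap.mulLeft k (gen q g) ∘ₗ
        (LinearMap.id - (parity q).toLinearMap)) by
    exact ⟨h.1, fun g => (Submodule.mem_iInf _).1 h.2 g⟩
  refine mem_of_gen_mul_mem (Submodule.mem_inf.2 ⟨?_, ?_⟩)
    (fun h w hw => Submodule.mem_inf.2 ⟨?_, ?_⟩) x
  · change 1 + parity q 1 ∈ SOq3 q
    rw [map_one]
    exact add_mem (one_mem _) (one_mem _)
  · rw [Submodule.mem_iInf]
    intro g
    change gen q g * (1 - parity q 1) ∈ SOq3 q
    rw [map_one, sub_self, mul_zero]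
    exact zero_mem _
  · have := (Submodule.mem_iInf _).1 hw.2 h
    change gen q h * (w - parity q w) ∈ SOq3 q at this
    change gen q h * w + parity q (gen q h * w) ∈ SOq3 q
    rwa [map_mul, parity_gen, neg_mul, ← sub_eq_add_neg, ← mul_sub]
  · rw [Submodule.mem_iInf]
    intro g
    have : w + parity q w ∈ SOq3 q := hw.1
    change gen q g * (gen q h * w - parity q (gen q h * w)) ∈ SOq3 q
    rw [map_mul, parity_gen, neg_mul, sub_neg_eq_add, ← mul_add, ← mul_assoc]
    exact mul_mem (SOq3.gen_mul_gen_mem q g h) this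

/-- An even element of the kernel of the projection to the torus is a combination of
`β` and `γ` with odd coefficients. -/
theorem exists_odd_of_toTorus_eq_zero (h2 : (2 : k) ≠ 0) {q : kˣ} {x : SUq2 q} (hx : x ∈ SOq3 q)
    (hx0 : toTorus q x = 0) : ∃ u v, x = β q * u + γ q * v ∧ (∀ g, gen q g * u ∈ SOq3 q) ∧
      ∀ g, gen q g * v ∈ SOq3 q := by
  obtain ⟨u, v, huv⟩ := mem_offDiagonal.1 (mem_offDiagonal_of_toTorus_eq_zero hx0)
  -- The odd parts of `u` and `v`: averaging `x = β u + γ v` with its image under `parity`, which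
  -- fixes `x` and negates `β`, `γ`, removes the even parts. The division by `2` is where the
  -- characteristic enters.
  refine ⟨(2 : k)⁻¹ • (u - parity q u), (2 : k)⁻¹ • (v - parity q v), ?_, fun g => ?_,
    fun g => ?_⟩
  · have h : -β q * parity q u + -γ q * parity q v = x := by
      have h := parity_eq_self hx
      nth_rewrite 1 [huv] at h
      rwa [map_add, map_mul, map_mul, ← gen_β, ← gen_γ, parity_gen, parity_gen] at h
    have h3 : (2 : k) • x = β q * (u - parity q u) + γ q * (v - parity q v) := by
      rw [two_smul]
      nth_rewrite 1 [huv]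
      rw [← h]
      noncomm_ring
    rw [mul_smul_comm, mul_smul_comm, ← smul_add, ← h3, smul_smul, inv_mul_cancel₀ h2, one_smul]
  · rw [mul_smul_comm]
    exact Subalgebra.smul_mem _ ((parity_mem q u).2 g) _
  · rw [mul_smul_comm]
    exact Subalgebra.smul_mem _ ((parity_mem q v).2 g) _

/-- Insert `1 = α δ - q β γ` after `β`. The factors `β α` and `β γ` lie in the sphere and in the
kernel, and `δ u`, `β u` are even when `u` is odd. `γ_mul_eq` does the same with `1 = δ α - q⁻¹ β
γ`. -/
theorem β_mul_eq (q : kˣ) (u : SUq2 q) : β q * u =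
    β q * α q * (δ q * u) - (q : k) • (β q * γ q * (β q * u)) := by
  have h : β q * α q * (δ q * u) = β q * (α q * δ q) * u := by simp only [mul_assoc]
  rw [h, α_mul_δ, mul_add, mul_one, add_mul, mul_smul_comm, smul_mul_assoc,
    (isQuantumMatrix q).bc]
  have h' : β q * (γ q * β q) * u = γ q * β q * (β q * u) := by
    rw [γ_mul_β, mul_assoc, mul_assoc, mul_assoc, ← mul_assoc (γ q), γ_mul_β, mul_assoc]
  rw [h', add_sub_cancel_right]

theorem γ_mul_eq (q : kˣ) (u : SUq2 q) : γ q * u =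
    γ q * δ q * (α q * u) - (q : k)⁻¹ • (β q * γ q * (γ q * u)) := by
  have h : γ q * δ q * (α q * u) = γ q * (δ q * α q) * u := by simp only [mul_assoc]
  rw [h, δ_mul_α, mul_add, mul_one, add_mul, mul_smul_comm, smul_mul_assoc]
  have h' : γ q * (β q * γ q) * u = β q * γ q * (γ q * u) := by
    rw [← mul_assoc (γ q), γ_mul_β, mul_assoc]
  rw [h', add_sub_cancel_right]

end Parity

/-! ### The right ideal of the 3D calculus -/

section Calculus

/-- The right ideal of the 3D calculus. -/
def calculusIdeal (q : kˣ) : Submodule k (SUq2 q) := rightIdealSpan k (calculusGenerators q)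

theorem mul_mem_calculusIdeal {q : kˣ} {x : SUq2 q} (hx : x ∈ calculusIdeal q) (a : SUq2 q) :
    x * a ∈ calculusIdeal q :=
  Submodule.smul_mem (Submodule.span (SUq2 q)ᵐᵒᵖ (calculusGenerators q)) (MulOpposite.op a) hx

theorem mem_calculusIdeal_of_mem {q : kˣ} {x : SUq2 q} (hx : x ∈ calculusGenerators q) :
    x ∈ calculusIdeal q :=
  Submodule.subset_span (R := (SUq2 q)ᵐᵒᵖ) hx

theorem calculusIdeal_le {q : kˣ} {W : Submodule k (SUq2 q)}
    (h : ∀ x ∈ calculusGenerators q, x ∈ W) (hW : IsRightIdeal W) : calculusIdeal q ≤ W := by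
  intro x hx
  change x ∈ Submodule.span (SUq2 q)ᵐᵒᵖ (calculusGenerators q) at hx
  induction hx using Submodule.span_induction with
  | mem x hx => exact h x hx
  | zero => exact zero_mem _
  | add x y _ _ hx hy => exact add_mem hx hy
  | smul a x _ hx => exact hW x hx a.unop

theorem calculusIdeal_le_ker (q : kˣ) : calculusIdeal q ≤
    LinearMap.ker (Coalgebra.counit (R := k) (A := SUq2 q)) := by
  refine calculusIdeal_le ?_ fun x hx a => ?_
  · rintro _ (rfl | rfl | rfl | rfl | rfl | rfl) <;> rw [LinearMap.mem_ker]
    · rw [map_sub, map_add, map_smul, counit_δ, counit_α, Bialgebra.counit_algebraMap]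
      simp
    all_goals
      simp only [pow_two, Bialgebra.counit_mul, counit_β, counit_γ, mul_zero]
  · rw [LinearMap.mem_ker] at hx ⊢
    rw [Bialgebra.counit_mul, hx, zero_mul]

/-- Five of the generators contain a factor `β` or `γ` and vanish on the torus; only the linear one
contributes. -/
theorem toTorus_mem_span {q : kˣ} {x : SUq2 q} (hx : x ∈ calculusIdeal q) : toTorus q x ∈
    Ideal.span {(T (-1) + C ((q : k) ^ 2) * T 1 - C (1 + (q : k) ^ 2) : k[T;T⁻¹])} := by
  set I := Ideal.span {(T (-1) + C ((q : k) ^ 2) * T 1 - C (1 + (q : k) ^ 2) : k[T;T⁻¹])}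
  suffices h : calculusIdeal q ≤ (I.restrictScalars k).comap (toTorus q).toLinearMap from h hx
  refine calculusIdeal_le ?_ fun x hx a => ?_
  · rintro _ (rfl | rfl | rfl | rfl | rfl | rfl) <;> change toTorus q _ ∈ I
    · rw [map_sub, map_add, map_smul, toTorus_δ, toTorus_α, AlgHom.commutes, smul_eq_C_mul]
      exact Ideal.subset_span rfl
    all_goals
      simp only [pow_two, map_mul, toTorus_β, toTorus_γ, mul_zero, zero_mem]
  · change toTorus q x ∈ I at hx
    change toTorus q (x * a) ∈ I
    rw [map_mul]
    exact I.mul_mem_right _ hx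

/-- With `X = δ + q² α` and `c = 1 + q²` one has `(X - c)(X + c) = X² - c²`. Here `X² = δ² + q⁴ α² +
2 q² + (q³ + q) β γ` and `c² - 2 q² = 1 + q⁴`. This gives an even element of the ideal. -/
theorem square_mem_calculusIdeal (q : kˣ) : δ q ^ 2 + (q : k) ^ 4 • α q ^ 2 -
    algebraMap k _ (1 + (q : k) ^ 4) ∈ calculusIdeal q := by
  set g := δ q + (q : k) ^ 2 • α q - algebraMap k _ (1 + (q : k) ^ 2) with hg
  have hgM : g ∈ calculusIdeal q := mem_calculusIdeal_of_mem (by simp [calculusGenerators, hg])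
  have hbc : β q * γ q ∈ calculusIdeal q :=
    mem_calculusIdeal_of_mem (by simp [calculusGenerators])
  have h : δ q ^ 2 + (q : k) ^ 4 • α q ^ 2 - algebraMap k _ (1 + (q : k) ^ 4) =
      g * δ q + (q : k) ^ 2 • (g * α q) + (1 + (q : k) ^ 2) • g -
        ((q : k) ^ 3 + q) • (β q * γ q) := by
    have hq : (q : k) ≠ 0 := q.ne_zero
    simp only [hg, Algebra.algebraMap_eq_smul_one, sub_mul, add_mul, smul_mul_assoc, one_mul,
      α_mul_δ, δ_mul_α, smul_add, smul_sub, smul_smul, pow_two (δ q), pow_two (α q)]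
    match_scalars <;> field_simp <;> ring
  rw [h]
  exact sub_mem (add_mem (add_mem (mul_mem_calculusIdeal hgM _)
    (Submodule.smul_mem _ _ (mul_mem_calculusIdeal hgM _))) (Submodule.smul_mem _ _ hgM))
    (Submodule.smul_mem _ _ hbc)

end Calculus

/-! ### The adjoint coaction of the torus -/

section Adjoint

/-- The antipode reverses products, but the torus is commutative; this is what makes `torusAd` an
algebra map. -/
theorem toTorus_antipode_mul (q : kˣ) (x y : SUq2 q) :
    toTorus q (HopfAlgebra.antipode k (x * y)) =
      toTorus q (HopfAlgebra.antipode k x) * toTorus q (HopfAlgebra.antipode k y) := by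
  rw [HopfAlgebra.antipode_mul_antidistrib, map_mul, mul_comm]

/-- The map `x ↦ 1 ⊗ t(S x)`, where `t` is the projection to the torus. -/
noncomputable def torusAntipode (q : kˣ) : SUq2 q →ₐ[k] SUq2 q ⊗[k] k[T;T⁻¹] :=
  Algebra.TensorProduct.includeRight.comp
    (AlgHom.ofLinearMap ((toTorus q).toLinearMap ∘ₗ HopfAlgebra.antipode k)
      (by simp [HopfAlgebra.antipode_one]) (toTorus_antipode_mul q))

theorem torusAntipode_apply (q : kˣ) (x : SUq2 q) :
    torusAntipode q x = 1 ⊗ₜ toTorus q (HopfAlgebra.antipode k x) := rfl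

theorem commute_torusAntipode (q : kˣ) (x : SUq2 q) (t : SUq2 q ⊗[k] k[T;T⁻¹]) :
    Commute (torusAntipode q x) t := by
  rw [torusAntipode_apply, Commute, SemiconjBy]
  induction t with
  | zero => simp
  | add a b ha hb => rw [mul_add, add_mul, ha, hb]
  | tmul a b => simp [mul_comm]

/-- The right adjoint coaction of the torus, as an algebra map. -/
noncomputable def torusAd (q : kˣ) : SUq2 q →ₐ[k] SUq2 q ⊗[k] k[T;T⁻¹] :=
  (Algebra.TensorProduct.lift (torusAntipode q) (pushCoaction (toTorusBialg q))
    fun x _ => commute_torusAntipode q x _).comp (Bialgebra.comulAlgHom k (SUq2 q))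

theorem torusAd_apply (q : kˣ) (x : SUq2 q) : torusAd q x =
    Algebra.TensorProduct.lift (torusAntipode q) (pushCoaction (toTorusBialg q))
      (fun x _ => commute_torusAntipode q x _) (Coalgebra.comul (R := k) x) := rfl

theorem torusAd_α (q : kˣ) : torusAd q (α q) = α q ⊗ₜ 1 := by
  simp only [torusAd_apply, comul_α, map_add, Algebra.TensorProduct.lift_tmul,
    torusAntipode_apply, antipode_α, antipode_β, toTorus_δ, map_smul, toTorus_β,
    torusCoaction_α, torusCoaction_γ, Algebra.TensorProduct.tmul_mul_tmul, one_mul, smul_zero,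
    TensorProduct.tmul_zero, zero_mul, add_zero, ← T_add]
  norm_num

theorem torusAd_β (q : kˣ) : torusAd q (β q) = β q ⊗ₜ T (-2) := by
  simp only [torusAd_apply, comul_β, map_add, Algebra.TensorProduct.lift_tmul,
    torusAntipode_apply, antipode_α, antipode_β, toTorus_δ, map_smul, toTorus_β,
    torusCoaction_β, torusCoaction_δ, Algebra.TensorProduct.tmul_mul_tmul, one_mul, smul_zero,
    TensorProduct.tmul_zero, zero_mul, add_zero, ← T_add]
  norm_num

theorem torusAd_γ (q : kˣ) : torusAd q (γ q) = γ q ⊗ₜ T 2 := by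
  simp only [torusAd_apply, comul_γ, map_add, Algebra.TensorProduct.lift_tmul,
    torusAntipode_apply, antipode_δ, antipode_γ, toTorus_α, map_smul, toTorus_γ,
    torusCoaction_α, torusCoaction_γ, Algebra.TensorProduct.tmul_mul_tmul, one_mul, smul_zero,
    TensorProduct.tmul_zero, zero_mul, zero_add, ← T_add]
  norm_num

theorem torusAd_δ (q : kˣ) : torusAd q (δ q) = δ q ⊗ₜ 1 := by
  simp only [torusAd_apply, comul_δ, map_add, Algebra.TensorProduct.lift_tmul,
    torusAntipode_apply, antipode_δ, antipode_γ, toTorus_α, map_smul, toTorus_γ,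
    torusCoaction_β, torusCoaction_δ, Algebra.TensorProduct.tmul_mul_tmul, one_mul, smul_zero,
    TensorProduct.tmul_zero, zero_mul, zero_add, ← T_add]
  norm_num

/-- Each of the six generators is homogeneous for `torusAd`, and `torusAd` is multiplicative, so the
right ideal they generate is carried into `M ⊗ k[T;T⁻¹]`. -/
theorem torusAd_mem {q : kˣ} {x : SUq2 q} (hx : x ∈ calculusIdeal q) :
    torusAd q x ∈ tensorRight (calculusIdeal q) k[T;T⁻¹] := by
  suffices h : calculusIdeal q ≤ (tensorRight (calculusIdeal q) k[T;T⁻¹]).comap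
      (torusAd q).toLinearMap from h hx
  refine calculusIdeal_le (fun x hx => ?_) fun x hx a => ?_
  · change torusAd q x ∈ tensorRight (calculusIdeal q) k[T;T⁻¹]
    suffices h : ∃ n, torusAd q x = x ⊗ₜ T n by
      obtain ⟨n, hn⟩ := h
      rw [hn]
      exact tmul_mem_tensorRight (mem_calculusIdeal_of_mem hx) _
    rcases hx with rfl | rfl | rfl | rfl | rfl | rfl
    · refine ⟨0, ?_⟩
      rw [map_sub, map_add, map_smul, torusAd_δ, torusAd_α, AlgHom.commutes, T_zero,
        TensorProduct.sub_tmul, TensorProduct.add_tmul, TensorProduct.smul_tmul']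
      rfl
    · exact ⟨4, by simp [pow_two, torusAd_γ, ← T_add]⟩
    · exact ⟨0, by
        rw [map_mul, torusAd_β, torusAd_γ, Algebra.TensorProduct.tmul_mul_tmul, ← T_add]
        rfl⟩
    · exact ⟨-4, by simp [pow_two, torusAd_β, ← T_add]⟩
    · exact ⟨2, by simp [torusAd_α, torusAd_γ, sub_mul, TensorProduct.sub_tmul]⟩
    · exact ⟨-2, by simp [torusAd_α, torusAd_β, sub_mul, TensorProduct.sub_tmul]⟩
  · change torusAd q x ∈ tensorRight (calculusIdeal q) k[T;T⁻¹] at hx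
    change torusAd q (x * a) ∈ tensorRight (calculusIdeal q) k[T;T⁻¹]
    rw [map_mul]
    revert hx
    generalize torusAd q x = s
    generalize torusAd q a = t
    rintro ⟨s, rfl⟩
    induction t with
    | zero => simp
    | add b c hb hc => rw [mul_add]; exact add_mem hb hc
    | tmul b f =>
      induction s with
      | zero => simp
      | add c d hc hd => rw [map_add, add_mul]; exact add_mem hc hd
      | tmul c h =>
        rw [LinearMap.rTensor_tmul, Algebra.TensorProduct.tmul_mul_tmul]
        exact tmul_mem_tensorRight (mul_mem_calculusIdeal c.2 b) (h * f)

end Adjoint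
end SUq2
end QuantumBundle

namespace QuantumBundle
-- Descent from `SU_q(2)` to `SO_q(3)`
namespace SOq3

universe u
variable {k : Type u} [Field k]

theorem tensorVal_comul (q : kˣ) (p : SOq3 q) : tensorVal (SOq3 q) (Coalgebra.comul (R := k) p) =
    Coalgebra.comul (R := k) (p : SUq2 q) :=
  (isHopfSubalgebra q).tensorVal_comulHom p

theorem coe_antipode (q : kˣ) (p : SOq3 q) : ((HopfAlgebra.antipode k p : SOq3 q) : SUq2 q) =
    HopfAlgebra.antipode k (p : SUq2 q) := rfl

theorem squareMap_proj (q : kˣ) (p : SOq3 q) : squareMap k (proj q p) = SUq2.toTorus q p :=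
  squareMap_projAlg q p

theorem proj_eq_zero_iff {q : kˣ} {p : SOq3 q} :
    proj q p = 0 ↔ SUq2.toTorus q (p : SUq2 q) = 0 := by
  rw [← squareMap_proj, map_eq_zero_iff (squareMap k) squareMap_injective]

theorem proj_surjective (q : kˣ) : Function.Surjective (proj q) := by
  have h : ∀ (p : SOq3 q) (n : ℤ), SUq2.toTorus q p = T (2 * n) → proj q p = T n :=
    fun p n hp => squareMap_injective (by rw [squareMap_proj, squareMap_T, hp])
  have h1 : proj q ⟨SUq2.α q * SUq2.α q, gen_mul_gen_mem q _ _⟩ = T 1 := by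
    refine h _ _ ?_
    change SUq2.toTorus q (SUq2.α q * SUq2.α q) = _
    rw [map_mul, SUq2.toTorus_α, ← T_add]
    rfl
  have h2 : proj q ⟨SUq2.δ q * SUq2.δ q, gen_mul_gen_mem q _ _⟩ = T (-1) := by
    refine h _ _ ?_
    change SUq2.toTorus q (SUq2.δ q * SUq2.δ q) = _
    rw [map_mul, SUq2.toTorus_δ, ← T_add]
    rfl
  intro f
  change f ∈ LinearMap.range (proj q : SOq3 q →ₗ[k] k[T;T⁻¹])
  refine laurent_mem_of_T_mem (fun n => ?_) f
  obtain ⟨m, rfl | rfl⟩ := n.eq_nat_or_neg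
  · refine ⟨⟨SUq2.α q * SUq2.α q, gen_mul_gen_mem q _ _⟩ ^ m, ?_⟩
    change proj q _ = _
    rw [map_pow, h1, T_pow, mul_one]
  · refine ⟨⟨SUq2.δ q * SUq2.δ q, gen_mul_gen_mem q _ _⟩ ^ m, ?_⟩
    change proj q _ = _
    rw [map_pow, h2, T_pow, mul_neg, mul_one]

section Inclusion

/-- The inclusion `SO_q(3) ⊗ k[Z, Z⁻¹] → SU_q(2) ⊗ k[Z^{1/2}, Z^{-1/2}]`. -/
noncomputable def inclTensor (q : kˣ) : SOq3 q ⊗[k] k[T;T⁻¹] →ₐ[k] SUq2 q ⊗[k] k[T;T⁻¹] :=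
  Algebra.TensorProduct.map (SOq3 q).val (squareMap k : k[T;T⁻¹] →ₐ[k] k[T;T⁻¹])

theorem inclTensor_tmul (q : kˣ) (p : SOq3 q) (f : k[T;T⁻¹]) :
    inclTensor q (p ⊗ₜ f) = (p : SUq2 q) ⊗ₜ squareMap k f := rfl

theorem inclTensor_injective (q : kˣ) : Function.Injective (inclTensor q) :=
  TensorProduct.map_injective_of_flat_flat (SOq3 q).val.toLinearMap
    (squareMap k : k[T;T⁻¹] →ₗ[k] k[T;T⁻¹]) Subtype.val_injective squareMap_injective

theorem inclTensor_lTensor_proj (q : kˣ) (t : SOq3 q ⊗[k] SOq3 q) :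
    inclTensor q ((proj q : SOq3 q →ₗ[k] k[T;T⁻¹]).lTensor (SOq3 q) t) =
      (SUq2.toTorusBialg q : SUq2 q →ₗ[k] k[T;T⁻¹]).lTensor (SUq2 q) (tensorVal (SOq3 q) t) := by
  induction t with
  | zero => simp only [map_zero]
  | add a b ha hb => simp only [map_add, ha, hb]
  | tmul a b => exact congrArg ((a : SUq2 q) ⊗ₜ[k] ·) (squareMap_proj q b)

theorem inclTensor_pushCoaction (q : kˣ) (p : SOq3 q) :
    inclTensor q (pushCoaction (proj q) p) = pushCoaction (SUq2.toTorusBialg q) (p : SUq2 q) := by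
  rw [pushCoaction_apply, pushCoaction_apply, inclTensor_lTensor_proj, tensorVal_comul]

/-- Reduces the `Ad`-condition on `SO_q(3)` to the algebra map `torusAd`, which is determined by the
generators. -/
theorem inclTensor_map_Ad (q : kˣ) (p : SOq3 q) :
    inclTensor q ((proj q : SOq3 q →ₗ[k] k[T;T⁻¹]).lTensor (SOq3 q) (Ad k (SOq3 q) p)) =
      SUq2.torusAd q (p : SUq2 q) := by
  rw [map_Ad_eq, SUq2.torusAd_apply, ← tensorVal_comul]
  generalize Coalgebra.comul (R := k) p = t
  induction t with
  | zero => simp only [map_zero]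
  | add a b ha hb => simp only [map_add, ha, hb]
  | tmul a b =>
    have h1 : inclTensor q (1 ⊗ₜ proj q (HopfAlgebra.antipode k a)) =
        SUq2.torusAntipode q (a : SUq2 q) := by
      rw [inclTensor_tmul, squareMap_proj, coe_antipode, SUq2.torusAntipode_apply]
      rfl
    change inclTensor q ((1 ⊗ₜ proj q (HopfAlgebra.antipode k a)) * pushCoaction (proj q) b) =
      SUq2.torusAntipode q (a : SUq2 q) * pushCoaction (SUq2.toTorusBialg q) (b : SUq2 q)
    rw [map_mul, h1, inclTensor_pushCoaction]

end Inclusion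

/-- The two coactions agree under the injection `inclTensor`, so the coinvariance equation can be
tested in `SU_q(2)`. -/
theorem mem_coinvariants_iff {q : kˣ} {p : SOq3 q} :
    p ∈ coinvariants (pushCoaction (proj q)) ↔ (p : SUq2 q) ∈ SUq2.sphere q := by
  rw [← SUq2.coinvariants_toTorusBialg]
  change pushCoaction (proj q) p = p ⊗ₜ 1 ↔
    pushCoaction (SUq2.toTorusBialg q) (p : SUq2 q) = (p : SUq2 q) ⊗ₜ 1
  rw [← (inclTensor_injective q).eq_iff, inclTensor_pushCoaction, inclTensor_tmul, map_one]

theorem map_val_sphere (q : kˣ) : (sphere q).map (SOq3 q).val = SUq2.sphere q := by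
  rw [sphere, AlgHom.map_adjoin, Set.image_insert_eq, Set.image_insert_eq, Set.image_singleton]
  rfl

theorem sphere_le (q : kˣ) : SUq2.sphere q ≤ SOq3 q := by
  rw [← map_val_sphere]
  rintro _ ⟨p, -, rfl⟩
  exact p.2

/-- The base of the bundle is the quantum sphere. -/
theorem sphere_eq_coinvariants (q : kˣ) : sphere q = coinvariants (pushCoaction (proj q)) := by
  ext p
  rw [mem_coinvariants_iff, ← map_val_sphere]
  exact ⟨fun h => ⟨p, h, rfl⟩, fun ⟨p', h, hp⟩ => Subtype.val_injective hp ▸ h⟩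

theorem mul_mem_coinvariants_inf_ker_mul_top {q : kˣ} {b y : SUq2 q} (hb : b ∈ SUq2.sphere q)
    (hb0 : SUq2.toTorus q b = 0) (hy : y ∈ SOq3 q) :
    (⟨b, sphere_le q hb⟩ : SOq3 q) * ⟨y, hy⟩ ∈
      (Subalgebra.toSubmodule (coinvariants (pushCoaction (proj q))) ⊓
        LinearMap.ker (proj q : SOq3 q →ₗ[k] k[T;T⁻¹])) * (⊤ : Submodule k (SOq3 q)) :=
  Submodule.mul_mem_mul (Submodule.mem_inf.2 ⟨mem_coinvariants_iff.2 hb, proj_eq_zero_iff.2 hb0⟩)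
    Submodule.mem_top

/-- An even element of the kernel is `β u + γ v` with `u`, `v` odd. By `β_mul_eq` and `γ_mul_eq` it
becomes a combination of four products, each of an element of the sphere in `ker π` and an even
element. -/
theorem isExactProjection_proj (h2 : (2 : k) ≠ 0) (q : kˣ) : IsExactProjection (proj q) := by
  intro x hx
  obtain ⟨u, v, hx, hu, hv⟩ := SUq2.exists_odd_of_toTorus_eq_zero h2 x.2 (proj_eq_zero_iff.1 hx)
  have hβα : SUq2.β q * SUq2.α q ∈ SUq2.sphere q := by
    have h : SUq2.β q * SUq2.α q = (q : k)⁻¹ • (SUq2.α q * SUq2.β q) := by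
      rw [(SUq2.isQuantumMatrix q).ab, smul_smul]
      simp
    rw [h]
    exact Subalgebra.smul_mem _ (SUq2.α_mul_β_mem_sphere q) _
  have h1 := mul_mem_coinvariants_inf_ker_mul_top hβα
    (by rw [map_mul, SUq2.toTorus_β, zero_mul]) (hu .δ)
  have h2 := mul_mem_coinvariants_inf_ker_mul_top (SUq2.β_mul_γ_mem_sphere q)
    (by rw [map_mul, SUq2.toTorus_β, zero_mul]) (hu .β)
  have h3 := mul_mem_coinvariants_inf_ker_mul_top (SUq2.γ_mul_δ_mem_sphere q)
    (by rw [map_mul, SUq2.toTorus_γ, zero_mul]) (hv .α)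
  have h4 := mul_mem_coinvariants_inf_ker_mul_top (SUq2.β_mul_γ_mem_sphere q)
    (by rw [map_mul, SUq2.toTorus_β, zero_mul]) (hv .γ)
  have h := add_mem (sub_mem h1 (Submodule.smul_mem _ (q : k) h2))
    (sub_mem h3 (Submodule.smul_mem _ (q : k)⁻¹ h4))
  convert! h using 1
  apply Subtype.ext
  rw [hx, SUq2.β_mul_eq q u, SUq2.γ_mul_eq q v]
  rfl

/-! ### The ideals `M_P` and `M_A` -/

section Ideals

theorem mem_idealP {q : kˣ} {p : SOq3 q} :
    p ∈ idealP q ↔ (p : SUq2 q) ∈ SUq2.calculusIdeal q := Iff.rfl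

theorem isLeftCovariantIdeal_idealP (q : kˣ) : IsLeftCovariantIdeal (idealP q) where
  rightIdeal _ hm a := SUq2.mul_mem_calculusIdeal hm (a : SUq2 q)
  le_ker _ hm := SUq2.calculusIdeal_le_ker q hm

theorem isRightIdeal_idealA (q : kˣ) : IsRightIdeal (idealA q) := by
  rintro _ ⟨p, hp, rfl⟩ a
  obtain ⟨a, rfl⟩ := proj_surjective q a
  exact ⟨p * a, (isLeftCovariantIdeal_idealP q).rightIdeal p hp a, map_mul (proj q) p a⟩

theorem isBicovariantIdeal_idealA (q : kˣ) : IsBicovariantIdeal (idealA q) where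
  rightIdeal := isRightIdeal_idealA q
  le_ker := by
    rintro _ ⟨p, hp, rfl⟩
    have h : Coalgebra.counit (R := k) p = 0 := (isLeftCovariantIdeal_idealP q).le_ker hp
    exact (CoalgHomClass.counit_comp_apply (proj q) p).trans h
  map_Ad_le := by
    rintro _ ⟨f, hf, rfl⟩
    rw [Ad_laurent]
    exact tmul_mem_tensorRight hf 1

/-- Invariance is known for `M` in `SU_q(2)`. As `M_P` is the preimage of `M`, the quotient of
`SO_q(3)` by `M_P` embeds in that of `SU_q(2)` by `M`. Tensoring with the injective `squareMap`
keeps this injective over a field, so vanishing upstairs implies vanishing downstairs. -/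
theorem map_Ad_idealP_le (q : kˣ) : (idealP q).map
    ((proj q : SOq3 q →ₗ[k] k[T;T⁻¹]).lTensor (SOq3 q) ∘ₗ Ad k (SOq3 q)) ≤
      tensorRight (idealP q) k[T;T⁻¹] := by
  rintro _ ⟨p, hp, rfl⟩
  have h := SUq2.torusAd_mem (mem_idealP.1 hp)
  rw [← inclTensor_map_Ad, mem_tensorRight_iff] at h
  change (proj q : SOq3 q →ₗ[k] k[T;T⁻¹]).lTensor (SOq3 q) (Ad k (SOq3 q) p) ∈ _
  revert h
  generalize (proj q : SOq3 q →ₗ[k] k[T;T⁻¹]).lTensor (SOq3 q) (Ad k (SOq3 q) p) = t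
  intro h
  let j : (SOq3 q ⧸ idealP q) →ₗ[k] (SUq2 q ⧸ SUq2.calculusIdeal q) :=
    (idealP q).mapQ (SUq2.calculusIdeal q) (SOq3 q).val.toLinearMap le_rfl
  have hj : Function.Injective j := by
    rw [← LinearMap.ker_eq_bot]
    exact Submodule.ker_liftQ_eq_bot' _ _ (by
      rw [LinearMap.ker_comp, Submodule.ker_mkQ]
      rfl)
  have hinj : Function.Injective (TensorProduct.map j (squareMap k : k[T;T⁻¹] →ₗ[k] k[T;T⁻¹])) :=
    TensorProduct.map_injective_of_flat_flat _ _ hj squareMap_injective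
  have key : ∀ t : SOq3 q ⊗[k] k[T;T⁻¹], TensorProduct.map j
      (squareMap k : k[T;T⁻¹] →ₗ[k] k[T;T⁻¹]) ((idealP q).mkQ.rTensor k[T;T⁻¹] t) =
      (SUq2.calculusIdeal q).mkQ.rTensor k[T;T⁻¹] (inclTensor q t) := by
    intro t
    induction t with
    | zero => simp only [map_zero]
    | add a b ha hb => simp only [map_add, ha, hb]
    | tmul a b => rfl
  rw [mem_tensorRight_iff]
  apply hinj
  rw [key, h, map_zero]

theorem isHomogeneousBundleData (h2 : (2 : k) ≠ 0) (q : kˣ) :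
    IsHomogeneousBundleData (proj q) (idealP q) (idealA q) where
  surjective := proj_surjective q
  exact := isExactProjection_proj h2 q
  calculus_total := isLeftCovariantIdeal_idealP q
  calculus_fiber := isBicovariantIdeal_idealA q
  map_Ad_le := map_Ad_idealP_le q
  eq_map := rfl

end Ideals

/-! ### The generator of `M_A` -/

section FiberIdeal

theorem generator_mem_idealA (q : kˣ) :
    T (-1) + C ((q : k) ^ 4) * T 1 - C (1 + (q : k) ^ 4) ∈ idealA q := by
  have hα : SUq2.α q ^ 2 ∈ SOq3 q := pow_two (SUq2.α q) ▸ gen_mul_gen_mem q .α .α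
  have hδ : SUq2.δ q ^ 2 ∈ SOq3 q := pow_two (SUq2.δ q) ▸ gen_mul_gen_mem q .δ .δ
  refine ⟨⟨_, sub_mem (add_mem hδ (Subalgebra.smul_mem _ hα _)) (Subalgebra.algebraMap_mem _ _)⟩,
    SUq2.square_mem_calculusIdeal q, squareMap_injective ((squareMap_proj q _).trans ?_)⟩
  simp only [map_sub, map_add, map_mul, map_pow, SUq2.toTorus_α, SUq2.toTorus_δ,
    C_eq_algebraMap, AlgHomClass.commutes, squareMap_T, T_pow, Algebra.smul_def]
  rfl

/-- Up to the unit `Z` the generator is a quadratic with invertible leading and constant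
coefficients, so `1` and `Z` span the quotient. -/
theorem exists_sub_mem_span (q : kˣ) (f : k[T;T⁻¹]) : ∃ a b : k, f - (C a + C b * T 1) ∈
    Ideal.span {T (-1) + C ((q : k) ^ 4) * T 1 - C (1 + (q : k) ^ 4)} := by
  set g : k[T;T⁻¹] := T (-1) + C ((q : k) ^ 4) * T 1 - C (1 + (q : k) ^ 4) with hg
  have hgI : g ∈ Ideal.span {g} := Ideal.subset_span rfl
  have hT : (T 1 * T (-1) : k[T;T⁻¹]) = 1 := by rw [← T_add]; rfl
  have hq : (C ((q : k) ^ 4)⁻¹ * C ((q : k) ^ 4) : k[T;T⁻¹]) = 1 := by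
    rw [← map_mul, inv_mul_cancel₀ (pow_ne_zero 4 q.ne_zero), map_one]
  have hstep : ∀ f, (∃ a b : k, f - (C a + C b * T 1) ∈ Ideal.span {g}) →
      ∃ a b : k, f * T 1 - (C a + C b * T 1) ∈ Ideal.span {g} := by
    rintro f ⟨a, b, h⟩
    -- From `Z² ≡ q⁻⁴ ((1 + q⁴) Z - 1)`.
    refine ⟨-(b * ((q : k) ^ 4)⁻¹), a + b * ((q : k) ^ 4)⁻¹ * (1 + (q : k) ^ 4), ?_⟩
    have := add_mem (Ideal.mul_mem_right (T 1) _ h)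
      (Ideal.mul_mem_left _ (C b * C ((q : k) ^ 4)⁻¹ * T 1) hgI)
    convert this using 1
    simp only [hg, map_add, map_mul, map_neg, map_one]
    linear_combination (-C b * T 1 * T 1) * hq - C b * C ((q : k) ^ 4)⁻¹ * hT
  have hstep' : ∀ f, (∃ a b : k, f - (C a + C b * T 1) ∈ Ideal.span {g}) →
      ∃ a b : k, f * T (-1) - (C a + C b * T 1) ∈ Ideal.span {g} := by
    rintro f ⟨a, b, h⟩
    -- From `Z⁻¹ ≡ (1 + q⁴) - q⁴ Z`.
    refine ⟨b + a * (1 + (q : k) ^ 4), -(a * (q : k) ^ 4), ?_⟩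
    have := add_mem (Ideal.mul_mem_right (T (-1)) _ h) (Ideal.mul_mem_left _ (C a) hgI)
    convert this using 1
    simp only [hg, map_add, map_mul, map_neg, map_one]
    linear_combination (C b) * hT
  have hmono : ∀ n : ℤ, ∃ a b : k, T n - (C a + C b * T 1) ∈ Ideal.span {g} := by
    intro n
    induction n with
    | zero => exact ⟨1, 0, by simp⟩
    | succ n ih => simpa only [T_add] using hstep _ ih
    | pred n ih =>
      rw [sub_eq_add_neg, T_add]
      exact hstep' _ ih
  induction f using LaurentPolynomial.induction_on' with
  | add p r hp hr =>
    obtain ⟨a, b, h⟩ := hp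
    obtain ⟨c, d, h'⟩ := hr
    refine ⟨a + c, b + d, ?_⟩
    convert add_mem h h' using 1
    simp only [map_add]
    ring
  | C_mul_T n c =>
    obtain ⟨a, b, h⟩ := hmono n
    refine ⟨c * a, c * b, ?_⟩
    convert Ideal.mul_mem_left _ (C c) h using 1
    simp only [map_mul]
    ring

/-- The companion matrix of `(q² T - 1) (T - 1)`, as a unit. -/
def companionUnit (q : kˣ) : (Matrix (Fin 2) (Fin 2) k)ˣ where
  val := !![0, 1; -((q : k) ^ 2)⁻¹, (1 + (q : k) ^ 2) * ((q : k) ^ 2)⁻¹]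
  inv := !![1 + (q : k) ^ 2, -(q : k) ^ 2; 1, 0]
  val_inv := by
    have hq : (q : k) ≠ 0 := q.ne_zero
    ext i j
    fin_cases i <;> fin_cases j <;> simp [Matrix.mul_apply, Fin.sum_univ_two]
    all_goals field_simp
    all_goals ring
  inv_val := by
    have hq : (q : k) ≠ 0 := q.ne_zero
    ext i j
    fin_cases i <;> fin_cases j <;> simp [Matrix.mul_apply, Fin.sum_univ_two]
    all_goals field_simp
    all_goals ring

/-- The evaluation of Laurent polynomials at `companionUnit`. -/
noncomputable def companionEval (q : kˣ) : k[T;T⁻¹] →ₐ[k] Matrix (Fin 2) (Fin 2) k :=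
  AddMonoidAlgebra.lift k _ ℤ ((Units.coeHom _).comp (zpowersHom _ (companionUnit q)))

theorem companionEval_T (q : kˣ) (n : ℤ) :
    companionEval q (T n) = ((companionUnit q ^ n : (Matrix (Fin 2) (Fin 2) k)ˣ) :
      Matrix (Fin 2) (Fin 2) k) := by
  rw [companionEval, T, AddMonoidAlgebra.lift_single, one_smul]
  rfl

/-- The companion matrix satisfies `q² X² - (1 + q²) X + 1 = 0`. Evaluating at it, and not at the
scalar roots `1` and `q⁻²`, also covers the double root `q² = 1`. -/
theorem companionEval_eq_zero {q : kˣ} {f : k[T;T⁻¹]}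
    (hf : f ∈ Ideal.span {T (-1) + C ((q : k) ^ 2) * T 1 - C (1 + (q : k) ^ 2)}) :
    companionEval q f = 0 := by
  obtain ⟨h, rfl⟩ := Ideal.mem_span_singleton.1 hf
  have hq : (q : k) ≠ 0 := q.ne_zero
  have h0 : companionEval q (T (-1) + C ((q : k) ^ 2) * T 1 - C (1 + (q : k) ^ 2)) = 0 := by
    rw [map_sub, map_add, map_mul, companionEval_T, companionEval_T, C_eq_algebraMap,
      C_eq_algebraMap, AlgHom.commutes, AlgHom.commutes, zpow_neg_one, zpow_one,
      ← Algebra.smul_def, Algebra.algebraMap_eq_smul_one]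
    change !![1 + (q : k) ^ 2, -(q : k) ^ 2; 1, 0] + (q : k) ^ 2 •
      !![0, 1; -((q : k) ^ 2)⁻¹, (1 + (q : k) ^ 2) * ((q : k) ^ 2)⁻¹] - _ = _
    ext i j
    fin_cases i <;> fin_cases j <;> simp
    all_goals field_simp
    all_goals ring
  rw [map_mul, h0, zero_mul]

/-- In the variable `T = Z^{1/2}` the element is `a + b T²`, so `a + b X²` vanishes for the
companion matrix `X`. The `(0, 1)` entry of `X²` is `(1 + q²) q⁻²`, nonzero precisely when `q² ≠
-1`; for `q² = -1` the matrix `X²` is scalar. -/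
theorem eq_zero_of_mem_idealA {q : kˣ} (hq2 : (q : k) ^ 2 ≠ -1) {a b : k}
    (h : C a + C b * T 1 ∈ idealA q) : a = 0 ∧ b = 0 := by
  obtain ⟨p, hp, hpf⟩ := h
  have h1 := companionEval_eq_zero (SUq2.toTorus_mem_span (mem_idealP.1 hp))
  have hpf' : proj q p = C a + C b * T 1 := hpf
  rw [← squareMap_proj, hpf'] at h1
  have hq : (q : k) ≠ 0 := q.ne_zero
  have h2 : algebraMap k (Matrix (Fin 2) (Fin 2) k) a +
      b • ((companionUnit q : Matrix (Fin 2) (Fin 2) k) * companionUnit q) = 0 := by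
    rw [map_add, map_mul, squareMap_T, C_eq_algebraMap, C_eq_algebraMap, AlgHomClass.commutes,
      AlgHomClass.commutes, map_add, map_mul, companionEval_T, AlgHom.commutes, AlgHom.commutes,
      ← Algebra.smul_def, mul_one, zpow_two] at h1
    exact h1
  have h00 := congrFun (congrFun h2 0) 0
  have h01 := congrFun (congrFun h2 0) 1
  simp [companionUnit, Algebra.algebraMap_eq_smul_one] at h00 h01
  have hq3 : 1 + (q : k) ^ 2 ≠ 0 := fun h => hq2 (by linear_combination h)
  have hb : b = 0 := by simpa [hq, hq3] using h01
  exact ⟨by simpa [hb] using h00, hb⟩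

theorem idealA_eq_span {q : kˣ} (hq2 : (q : k) ^ 2 ≠ -1) :
    idealA q = (Ideal.span {T (-1) + C ((q : k) ^ 4) * T 1 - C (1 + (q : k) ^ 4)} :
      Ideal k[T;T⁻¹]).restrictScalars k := by
  have hle : (Ideal.span {T (-1) + C ((q : k) ^ 4) * T 1 - C (1 + (q : k) ^ 4)} :
      Ideal k[T;T⁻¹]).restrictScalars k ≤ idealA q := by
    intro f hf
    obtain ⟨h, rfl⟩ := Ideal.mem_span_singleton.1 hf
    exact isRightIdeal_idealA q _ (generator_mem_idealA q) h
  refine le_antisymm (fun f hf => ?_) hle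
  obtain ⟨a, b, h⟩ := exists_sub_mem_span q f
  -- The remainder of `f` modulo the generator stays in `M_A`, since the generator is already known
  -- to lie there.
  have h1 : C a + C b * T 1 ∈ idealA q := by simpa using sub_mem hf (hle h)
  obtain ⟨rfl, rfl⟩ := eq_zero_of_mem_idealA hq2 h1
  simpa using h

end FiberIdeal
end SOq3
end QuantumBundle

theorem proposition5p12 {k : Type*} [Field k] (h2 : (2 : k) ≠ 0) (q : kˣ) :
    -- the data satisfy the hypotheses of the criterion for homogeneous bundles
    IsHomogeneousBundleData (SOq3.proj q) (SOq3.idealP q) (SOq3.idealA q) ∧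
    -- the induced ideal `M_A = π(M_P)` is generated by `Z⁻¹ + q⁴ Z - (1 + q⁴)`
    ((q : k) ^ 2 ≠ -1 →
      SOq3.idealA q = (Ideal.span {T (-1) + C ((q : k) ^ 4) * T 1 - C (1 + (q : k) ^ 4)} :
        Ideal k[T;T⁻¹]).restrictScalars k) ∧
    -- `P(B, A, π, M_P, M_A)` is a quantum principal bundle with base `S_q²`
    IsQuantumPrincipalBundle (pushCoaction (SOq3.proj q)) (SOq3.sphere q)
      (formsOfIdeal (SOq3.idealP q)) (SOq3.idealA q) := by
  have h := SOq3.isHomogeneousBundleData h2 q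
  refine ⟨h, SOq3.idealA_eq_span, ?_⟩
  rw [SOq3.sphere_eq_coinvariants]
  exact h.isQuantumPrincipalBundle
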